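/- **Theorem W (Whittle's theorem).** Let $d\ge 1$, $\alpha,\kappa,\sigma>0$, $\eta:=(\alpha-d)/2$, and let $$c_\eta(s,t)=\frac{\sigma^2}{\Gamma(\eta+d/2)\,(4\pi)^{d/2}\,\kappa^{2\eta}\,2^{\eta-1}}\,(\kappa\|s-t\|)^{\eta}K_\eta(\kappa\|s-t\|),\qquad s,t\in\mathbb R^d,$$ be the Matérn covariance function, where $K_\nu(x)=\frac12\int_0^\infty u^{\nu}\exp\{-\frac x2(u+\frac1u)\}\,\frac{du}{u}$ is the Macdonald function. Let $W$ be Gaussian white noise on $\mathbb R^d$, that is, a centred Gaussian family $W(f)=\int f\,dW$, $f\in L^2(\mathbb R^d)$, with $E[W(f)W(g)]=\int fg$. Test functions are the real-valued Schwartz functions on $\mathbb R^d$, on which $(\kappa^2-\Delta)^{\beta/2}$, $\beta\in\mathbb R$, is the Fourier multiplier with symbol $(\kappa^2+4\pi^2|\xi|^2)^{\beta/2}$ (for $\hat f(\xi)=\int e^{-2\pi i\langle x,\xi\rangle}f(x)\,dx$). Consider the SPDE $$(\kappa^2-\Delta)^{\alpha/2}X=\sigma W\quad\text{on }\mathbb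 R^d. \tag{SPDE}$$ (1) *Kernel.* $\sigma^{-2}c_\eta$ is the kernel of the Bessel potential $(\kappa^2-\Delta)^{-\alpha/2}$: the function $x\mapsto\sigma^{-2}c_\eta(x,0)$ is integrable with Fourier transform $(\kappa^2+4\pi^2|\xi|^2)^{-\alpha/2}$, and $(\kappa^2-\Delta)^{-\alpha/2}\psi(s)=\sigma^{-2}\int c_\eta(s,t)\psi(t)\,dt$ (absolutely convergent) for every test function $\psi$ and every $s$. (2) *Generalized fields, all $\alpha>0$.* For every test function $\psi$ the function $t\mapsto\int c_\eta(s,t)\psi(s)\,ds$ is in $L^2(\mathbb R^d)$. A family of real functions $X(\psi)$ on the probability space, indexed by the test functions $\psi$, is a stationary generalized random field (random variables depending linearly and continuously in probability on $\psi$, with translation-invariant finite-dimensional distributions) that solves (SPDE) in the sense that $X((\kappa^2-\Delta)^{\alpha/2}\varphi)=\sigma\int\varphi\,dW$ a.s. for every test function $\varphi$, if and only if for every test function $\psi$ $$X(\psi)=\sigma^{-1}\int_{\mathbb R^d}\Big(\int_{\mathbb R^d}c_\eta(s,t)\psi(s)\,ds\Big)dW(t)\quad\text{a.s.}$$ (3)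 *Random fields, $\alpha>d/2$.* Then $c_\eta(s,\cdot)\in L^2(\mathbb R^d)$ for every $s$. Call a jointly measurable random field $X(s)$, $s\in\mathbb R^d$, a solution of (SPDE) if for every test function $\varphi$, almost surely, $$\int X(s)\,(\kappa^2-\Delta)^{\alpha/2}\varphi(s)\,ds=\sigma\int\varphi(s)\,dW(s),$$ the integral on the left being absolutely convergent. A jointly measurable random field $X$ is a (strictly) stationary solution if and only if it is the convolution $$X(s)=\sigma^{-1}\int_{\mathbb R^d}c_\eta(s,t)\,dW(t)\quad\text{a.s., for every }s\in\mathbb R^d,$$ and such a field exists. Moreover, if $Z$ is a jointly measurable version of this convolution, then a jointly measurable random field $X$ is a solution if and only if for every test function $\psi$, almost surely, $\psi X$ and $\psi Z$ are integrable over $\mathbb R^d$ and $$\int_{\mathbb R^d}\psi(s)X(s)\,ds=\int_{\mathbb R^d}\psi(s)Z(s)\,ds .$$ -/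

import Mathlib

open MeasureTheory ProbabilityTheory Real Set Topology
open scoped SchwartzMap FourierTransform

noncomputable section

namespace Whittle

/-- The Euclidean space `ℝ^d`. -/
abbrev E (d : ℕ) : Type := EuclideanSpace ℝ (Fin d)

/-! ### The operator `(κ² - Δ)^{β/2}` on test functions -/

/-- The Fourier symbol `(κ² + 4π²|ξ|²)^{β/2}` of `(κ² - Δ)^{β/2}`, for the Fourier transform
`𝓕 f (ξ) = ∫ exp (-2πi ⟨x, ξ⟩) f x dx`. -/
def symbol (d : ℕ) (κ β : ℝ) (ξ : E d) : ℝ := (κ ^ 2 + 4 * π ^ 2 * ‖ξ‖ ^ 2) ^ (β / 2)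

/-- A real-valued Schwartz function regarded as a complex-valued one. -/
def complexify {d : ℕ} (φ : 𝓢(E d, ℝ)) : 𝓢(E d, ℂ) :=
  SchwartzMap.postcompCLM (𝕜 := ℝ) Complex.ofRealCLM φ

/-- The operator `(κ² - Δ)^{β/2}`, `β ∈ ℝ`, on real-valued Schwartz functions: the Fourier
multiplier with the above symbol. As the symbol is real and even, the multiplier maps real-valued
functions to real-valued functions, so that taking real parts only serves to land in
real-valued functions (see `fourier_fracOp`). -/
def fracOp {d : ℕ} (κ β : ℝ) (φ : 𝓢(E d, ℝ)) : 𝓢(E d, ℝ) :=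
  SchwartzMap.postcompCLM (𝕜 := ℝ) Complex.reCLM
    (SchwartzMap.fourierMultiplierCLM ℂ (fun ξ : E d ↦ (symbol d κ β ξ : ℂ)) (complexify φ))

theorem symbol_hasTemperateGrowth (d : ℕ) {κ : ℝ} (hκ : 0 < κ) (β : ℝ) :
    (symbol d κ β).HasTemperateGrowth := by
  have h1 : (fun x : E d ↦ (1 + ‖x‖ ^ 2) ^ (β / 2)).HasTemperateGrowth :=
    Function.hasTemperateGrowth_one_add_norm_sq_rpow (E d) (β / 2)
  have h2 : (fun x : E d ↦ (2 * π / κ) • x).HasTemperateGrowth :=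
    ((2 * π / κ) • ContinuousLinearMap.id ℝ (E d)).hasTemperateGrowth
  have h3 := (Function.HasTemperateGrowth.const (E := E d) ((κ ^ 2) ^ (β / 2) : ℝ)).mul
    (h1.comp h2)
  refine (congrArg Function.HasTemperateGrowth ?_).mpr h3
  funext x
  simp only [symbol, Pi.mul_apply, Function.comp_apply]
  rw [← mul_rpow (by positivity) (by positivity)]
  congr 1
  rw [norm_smul, mul_pow, Real.norm_eq_abs, sq_abs]
  field_simp
  ring

/-- On the Fourier side, `(κ² - Δ)^{β/2}` is the multiplication with `(κ² + 4π²|ξ|²)^{β/2}`. -/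
theorem fourier_fracOp {d : ℕ} {κ : ℝ} (hκ : 0 < κ) (β : ℝ) (φ : 𝓢(E d, ℝ)) (ξ : E d) :
    𝓕 (fun x : E d ↦ (fracOp κ β φ x : ℂ)) ξ
      = (symbol d κ β ξ : ℂ) * 𝓕 (fun x : E d ↦ (φ x : ℂ)) ξ := by
  have hg : (fun ξ : E d ↦ (symbol d κ β ξ : ℂ)).HasTemperateGrowth :=
    Function.HasTemperateGrowth.comp Function.Complex.hasTemperateGrowth_ofReal (symbol_hasTemperateGrowth d hκ β)
  set F := SchwartzMap.fourierMultiplierCLM ℂ (fun ξ : E d ↦ (symbol d κ β ξ : ℂ)) (complexify φ)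
    with hF
  have hφ : (complexify φ : E d → ℂ) = fun x ↦ (φ x : ℂ) := rfl
  have hF' : 𝓕 F = SchwartzMap.smulLeftCLM ℂ (fun ξ : E d ↦ (symbol d κ β ξ : ℂ))
      (𝓕 (complexify φ)) := by
    rw [hF, SchwartzMap.fourierMultiplierCLM_apply, FourierTransform.fourier_fourierInv_eq]
  have hval (ζ : E d) : 𝓕 (F : E d → ℂ) ζ
      = (symbol d κ β ζ : ℂ) * 𝓕 (fun x : E d ↦ (φ x : ℂ)) ζ := by
    rw [← SchwartzMap.fourier_coe, hF', SchwartzMap.smulLeftCLM_apply_apply hg,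
      SchwartzMap.fourier_coe, hφ, smul_eq_mul]
  -- the multiplier maps real functions to real functions
  have hconj (ζ : E d) : (starRingEnd ℂ) (𝓕 (F : E d → ℂ) ζ) = 𝓕 (F : E d → ℂ) (-ζ) := by
    rw [hval, hval, map_mul, Complex.conj_ofReal]
    congr 1
    · simp [symbol]
    · rw [Real.fourier_eq', Real.fourier_eq', ← integral_conj]
      congr 1
      funext v
      simp [← Complex.exp_conj, Complex.conj_ofNat]
  have hreal (x : E d) : ((F x).re : ℂ) = F x := by
    rw [← Complex.conj_eq_iff_re]
    have h1 : F x = 𝓕⁻ (𝓕 (F : E d → ℂ)) x := by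
      rw [← SchwartzMap.fourier_coe, ← SchwartzMap.fourierInv_coe,
        FourierTransform.fourierInv_fourier_eq]
    rw [h1, Real.fourierInv_eq', ← integral_conj,
      ← integral_neg_eq_self (fun v : E d ↦ Complex.exp _ • 𝓕 (F : E d → ℂ) v)]
    congr 1
    funext v
    rw [smul_eq_mul, map_mul, hconj, ← Complex.exp_conj, smul_eq_mul]
    simp [Complex.conj_ofNat]
  have : (fun x : E d ↦ (fracOp κ β φ x : ℂ)) = F := by
    funext x
    exact hreal x
  rw [this, hval]

/-! ### The Matérn kernel -/

/-- The Macdonald function (modified Bessel function of the third kind)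
`K_ν(x) = ½ ∫_0^∞ u^ν exp (-(x/2) (u + 1/u)) du/u`, for `x > 0`. -/
def macdonaldK (ν x : ℝ) : ℝ :=
  1 / 2 * ∫ u in Ioi (0 : ℝ), u ^ (ν - 1) * exp (-(x / 2) * (u + 1 / u))

/-- The function `r ↦ r^η K_η(r)` on `[0, ∞)`. For `η > 0` the value at `0` is the limit
`2^(η-1) Γ(η)`; for `η ≤ 0` the limit is infinite and the value at `0` has no significance. -/
def powMacdonald (η r : ℝ) : ℝ :=
  if r = 0 then 2 ^ (η - 1) * Gamma η else r ^ η * macdonaldK η r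

/-- The Matérn covariance
`c_η(s,t) = σ² / (Γ(η+d/2) (4π)^{d/2} κ^{2η} 2^{η-1}) (κ|s-t|)^η K_η(κ|s-t|)`. -/
def maternCov {d : ℕ} (η κ σ : ℝ) (s t : E d) : ℝ :=
  σ ^ 2 / (Gamma (η + d / 2) * (4 * π) ^ ((d : ℝ) / 2) * κ ^ (2 * η) * 2 ^ (η - 1))
    * powMacdonald η (κ * ‖s - t‖)

/-! ### White noise and random fields -/

variable {Ω : Type*} [MeasurableSpace Ω]

/-- White noise on `ℝ^d`, as the isonormal Gaussian process over `L²(ℝ^d)`: a centred Gaussian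
family `W f`, `f ∈ L²(ℝ^d)`, with `E (W f · W g) = ∫ f g`. -/
structure IsWhiteNoise {d : ℕ} (W : Lp ℝ 2 (volume : Measure (E d)) → Ω → ℝ) (P : Measure Ω) :
    Prop where
  gaussian : IsGaussianProcess W P
  mean : ∀ f, ∫ ω, W f ω ∂P = 0
  cov : ∀ f g, ∫ ω, W f ω * W g ω ∂P = inner ℝ f g

open Classical in
/-- The Wiener integral `∫ f dW` of a square-integrable function against white noise
(`0` by convention if `f` is not square-integrable). -/
def wienerIntegral {d : ℕ} (W : Lp ℝ 2 (volume : Measure (E d)) → Ω → ℝ) (f : E d → ℝ) :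
    Ω → ℝ :=
  if h : MemLp f 2 (volume : Measure (E d)) then W h.toLp else 0

/-- (Strict) stationarity of a random field: the finite-dimensional distributions are invariant
under translations. -/
def IsStationaryField {d : ℕ} (X : E d → Ω → ℝ) (P : Measure Ω) : Prop :=
  ∀ (h : E d) (I : Finset (E d)),
    IdentDistrib (fun ω (s : I) ↦ X (s + h) ω) (fun ω (s : I) ↦ X s ω) P P

/-- `X` is a solution of `(κ² - Δ)^{α/2} X = σ W`: for every test function `φ`, almost surely
`∫ X(s) (κ² - Δ)^{α/2} φ(s) ds = σ ∫ φ(s) dW(s)`, the first integral being convergent. -/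
def IsSolutionField {d : ℕ} (W : Lp ℝ 2 (volume : Measure (E d)) → Ω → ℝ) (P : Measure Ω)
    (α κ σ : ℝ) (X : E d → Ω → ℝ) : Prop :=
  ∀ φ : 𝓢(E d, ℝ), ∀ᵐ ω ∂P,
    Integrable (fun s ↦ X s ω * fracOp κ α φ s) ∧
      ∫ s, X s ω * fracOp κ α φ s = σ * wienerIntegral W φ ω

/-- Generalized random fields: random variables `X ψ` that depend linearly and continuously
(in probability) on the test function `ψ`. -/
structure IsGeneralizedField {d : ℕ} (X : 𝓢(E d, ℝ) → Ω → ℝ) (P : Measure Ω) : Prop where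
  aemeasurable : ∀ ψ, AEMeasurable (X ψ) P
  linear : ∀ (a b : ℝ) (φ ψ : 𝓢(E d, ℝ)),
    ∀ᵐ ω ∂P, X (a • φ + b • ψ) ω = a * X φ ω + b * X ψ ω
  continuous : ∀ ψ, TendstoInMeasure P X (𝓝 ψ) (X ψ)

/-- (Strict) stationarity of a generalized random field. -/
def IsStationaryGeneralized {d : ℕ} (X : 𝓢(E d, ℝ) → Ω → ℝ) (P : Measure Ω) : Prop :=
  ∀ (h : E d) (I : Finset 𝓢(E d, ℝ)),
    IdentDistrib (fun ω (ψ : I) ↦ X (SchwartzMap.compSubConstCLM ℝ h ψ) ω)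
      (fun ω (ψ : I) ↦ X ψ ω) P P

/-- `X` is a generalized solution of `(κ² - Δ)^{α/2} X = σ W`: for every test function `φ`, almost
surely `X ((κ² - Δ)^{α/2} φ) = σ ∫ φ dW`. -/
def IsSolutionGeneralized {d : ℕ} (W : Lp ℝ 2 (volume : Measure (E d)) → Ω → ℝ) (P : Measure Ω)
    (α κ σ : ℝ) (X : 𝓢(E d, ℝ) → Ω → ℝ) : Prop :=
  ∀ φ : 𝓢(E d, ℝ), ∀ᵐ ω ∂P, X (fracOp κ α φ) ω = σ * wienerIntegral W φ ω

/-- `X(s) = σ⁻¹ ∫ c_η(s,t) dW(t)` almost surely, for every `s`. -/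
def IsConvolutionField {d : ℕ} (W : Lp ℝ 2 (volume : Measure (E d)) → Ω → ℝ) (P : Measure Ω)
    (η κ σ : ℝ) (X : E d → Ω → ℝ) : Prop :=
  ∀ s : E d, ∀ᵐ ω ∂P, X s ω = σ⁻¹ * wienerIntegral W (fun t ↦ maternCov η κ σ s t) ω

end Whittle

end

namespace Whittle

/-! ### Bessel kernels as mixtures of heat kernels. -/

section BesselKernel

variable {d : ℕ}

/-! On Schwartz functions `(κ² - Δ)^{α/2}` is a bijection with inverse `(κ² - Δ)^{-α/2}`, since its
symbol is positive and both powers have temperate growth. Testing the equation with `(κ² - Δ)^{-α/2}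
ψ` turns it into `X ψ = σ W((κ² - Δ)^{-α/2} ψ)`, which determines a generalized solution. The right
side is linear and continuous in `ψ` because `W` is a linear isometry into `L²(P)`, and stationary
because its Gram matrix is translation invariant (`IsWhiteNoise.generalized_iff`).

The Matérn function enters through `r^{-a} = Γ(a)⁻¹ ∫ t^{a-1} e^{-rt} dt` at `r = κ² + 4π²‖ξ‖²`, `a
= α/2`: since `e^{-4π²‖ξ‖²t}` is the Fourier transform of the heat kernel, the Bessel kernel is a
mixture of heat kernels, and a rescaling of `t` gives Macdonald's integral
(`maternCov_eq_besselKernel`).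

For `α > d/2` the kernel lies in `L²` (`memLp_two_besselKernel`), so the convolution field `Z`
exists, and stochastic Fubini (`IsConvolutionField.ae_integral`) gives `∫ ψ Z = σ W((κ² - Δ)^{-α/2}
ψ)`. Solutions are thus the fields with the same integrals as `Z`. Countably many test functions
then give `X(s) = Z(s)` a.s. for almost every `s`; stationarity and `L²`-continuity of `Z` extend
this to every `s` (`IsStationaryField.ae_eq_of_ae_ae_eq`). -/

/-- The heat kernel `(4πt)^{-d/2} exp (-‖x‖²/(4t))` on `ℝ^d`. -/
noncomputable def heatKernel (d : ℕ) (t : ℝ) (x : E d) : ℝ :=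
  (4 * π * t) ^ (-(d : ℝ) / 2) * exp (-(1 / (4 * t)) * ‖x‖ ^ 2)

/-- The integrand `t^{a-1} exp (-κ²t) p_t(x)` of the subordination formula. -/
noncomputable def subordinand (d : ℕ) (a κ t : ℝ) (x : E d) : ℝ :=
  t ^ (a - 1) * exp (-(κ ^ 2 * t)) * heatKernel d t x

/-- The kernel of the Bessel potential `(κ² - Δ)^{-a}`, as a mixture of heat kernels. -/
noncomputable def besselKernel (d : ℕ) (a κ : ℝ) (x : E d) : ℝ :=
  (Gamma a)⁻¹ * ∫ t in Ioi (0 : ℝ), subordinand d a κ t x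

theorem measurable_uncurry_subordinand (a κ : ℝ) :
    Measurable (Function.uncurry (subordinand d a κ)) := by
  unfold subordinand heatKernel Function.uncurry
  fun_prop

theorem subordinand_nonneg (a κ : ℝ) {t : ℝ} (ht : 0 < t) (x : E d) :
    0 ≤ subordinand d a κ t x := by
  unfold subordinand heatKernel
  positivity

theorem integrable_exp_neg_mul_norm_sq {b : ℝ} (hb : 0 < b) :
    Integrable (fun x : E d ↦ exp (-b * ‖x‖ ^ 2)) := by
  have h := (GaussianFourier.integrable_cexp_neg_mul_sq_norm_add (V := E d) (b := (b : ℂ))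
    (by simpa using hb) 0 0).re
  refine h.congr (Filter.Eventually.of_forall fun x ↦ ?_)
  simp only [inner_zero_left, Complex.ofReal_zero, mul_zero, add_zero]
  norm_cast

theorem integrable_heatKernel {t : ℝ} (ht : 0 < t) : Integrable (heatKernel d t) :=
  (integrable_exp_neg_mul_norm_sq (by positivity)).const_mul _

theorem integral_heatKernel {t : ℝ} (ht : 0 < t) : ∫ x, heatKernel d t x = 1 := by
  unfold heatKernel
  rw [integral_const_mul, GaussianFourier.integral_rexp_neg_mul_sq_norm (by positivity),
    finrank_euclideanSpace_fin, neg_div, rpow_neg (by positivity)]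
  rw [show π / (1 / (4 * t)) = 4 * π * t by field_simp]
  exact inv_mul_cancel₀ (by positivity)

theorem fourier_heatKernel {t : ℝ} (ht : 0 < t) (ξ : E d) :
    𝓕 (fun x : E d ↦ (heatKernel d t x : ℂ)) ξ = (exp (-(4 * π ^ 2 * ‖ξ‖ ^ 2 * t)) : ℂ) := by
  have h := fourier_gaussian_innerProductSpace (V := E d) (b := ((1 / (4 * t) : ℝ) : ℂ))
    (by rw [Complex.ofReal_re]; positivity) ξ
  have h1 : (fun x : E d ↦ (heatKernel d t x : ℂ)) = (((4 * π * t) ^ (-(d : ℝ) / 2) : ℝ) : ℂ) •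
      fun x : E d ↦ Complex.exp (-((1 / (4 * t) : ℝ) : ℂ) * ‖x‖ ^ 2) := by
    funext x
    simp [heatKernel]
  have h5 (c : ℂ) (f : E d → ℂ) : 𝓕 (c • f) ξ = c • 𝓕 f ξ := by
    simp only [Real.fourier_eq, ← integral_smul, Pi.smul_apply]
    simp_rw [smul_comm c]
  rw [h1, h5, h, finrank_euclideanSpace_fin]
  have h2 : ((π : ℂ) / ((1 / (4 * t) : ℝ) : ℂ)) ^ ((d : ℂ) / 2)
      = (((4 * π * t) ^ ((d : ℝ) / 2) : ℝ) : ℂ) := by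
    rw [Complex.ofReal_cpow (by positivity)]
    congr 1
    · push_cast
      field_simp
    · push_cast
      rfl
  rw [h2, smul_eq_mul, ← mul_assoc, ← Complex.ofReal_mul, ← rpow_add (by positivity)]
  have h3 : -(d : ℝ) / 2 + (d : ℝ) / 2 = 0 := by ring
  rw [h3, rpow_zero, Complex.ofReal_one, one_mul]
  have : (t : ℂ) ≠ 0 := by exact_mod_cast ht.ne'
  push_cast
  field_simp

theorem integrable_rpow_mul_exp {a r : ℝ} (ha : 0 < a) (hr : 0 < r) :
    IntegrableOn (fun t : ℝ ↦ t ^ (a - 1) * exp (-(r * t))) (Ioi 0) := by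
  have := integrableOn_rpow_mul_exp_neg_mul_rpow (s := a - 1) (p := 1) (b := r)
    (by linarith) one_pos hr
  simpa using this

/-- By Tonelli: heat kernels have mass one, so integrating out `x` leaves a Gamma integrand in `t`.
-/
theorem integrable_subordinand {a κ : ℝ} (ha : 0 < a) (hκ : 0 < κ) :
    Integrable (Function.uncurry (subordinand d a κ))
      ((volume.restrict (Ioi 0)).prod volume) := by
  rw [integrable_prod_iff (measurable_uncurry_subordinand a κ).aestronglyMeasurable]
  refine ⟨?_, ?_⟩
  · filter_upwards [self_mem_ae_restrict measurableSet_Ioi] with t ht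
    exact (integrable_heatKernel ht).const_mul (t ^ (a - 1) * exp (-(κ ^ 2 * t)))
  · refine (integrable_rpow_mul_exp ha (by positivity : 0 < κ ^ 2)).congr ?_
    filter_upwards [self_mem_ae_restrict measurableSet_Ioi] with t ht
    have : (fun x : E d ↦ ‖Function.uncurry (subordinand d a κ) (t, x)‖)
        = fun x ↦ t ^ (a - 1) * exp (-(κ ^ 2 * t)) * heatKernel d t x := by
      funext x
      exact Real.norm_of_nonneg (subordinand_nonneg a κ ht x)
    rw [this, integral_const_mul, integral_heatKernel ht, mul_one]

theorem integrable_besselKernel {a κ : ℝ} (ha : 0 < a) (hκ : 0 < κ) :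
    Integrable (besselKernel d a κ) :=
  (integrable_subordinand ha hκ).integral_prod_right.const_mul _

/-- Fubini moves the Fourier transform onto the heat kernels; what remains is the Gamma integral
with rate `κ² + 4π²‖ξ‖²`. -/
theorem fourier_besselKernel {a κ : ℝ} (ha : 0 < a) (hκ : 0 < κ) (ξ : E d) :
    𝓕 (fun x : E d ↦ (besselKernel d a κ x : ℂ)) ξ
      = (((κ ^ 2 + 4 * π ^ 2 * ‖ξ‖ ^ 2) ^ (-a) : ℝ) : ℂ) := by
  have hr : 0 < κ ^ 2 + 4 * π ^ 2 * ‖ξ‖ ^ 2 := by positivity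
  have hint := (integrable_subordinand (d := d) ha hκ).ofReal (𝕜 := ℂ)
  have h1 : 𝓕 (fun x : E d ↦ (besselKernel d a κ x : ℂ)) ξ
      = ((Gamma a)⁻¹ : ℂ) * ∫ x, ∫ t in Ioi (0 : ℝ),
        Real.fourierChar (-inner ℝ x ξ) • (subordinand d a κ t x : ℂ) := by
    rw [Real.fourier_eq, ← integral_const_mul]
    congr 1
    funext x
    simp only [Circle.smul_def, smul_eq_mul]
    rw [integral_const_mul, besselKernel, integral_complex_ofReal]
    push_cast
    ring
  have hswap : Integrable (Function.uncurry fun (x : E d) (t : ℝ) ↦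
      Real.fourierChar (-inner ℝ x ξ) • (subordinand d a κ t x : ℂ))
      (volume.prod (volume.restrict (Ioi 0))) := by
    refine (hint.swap).mono ?_ (Filter.Eventually.of_forall fun p ↦ ?_)
    · refine AEStronglyMeasurable.fun_smul (𝕜 := Circle) ?_ hint.swap.aestronglyMeasurable
      exact (Continuous.aestronglyMeasurable (by fun_prop))
    · simp [Function.uncurry, Circle.norm_smul]
  rw [h1, integral_integral_swap hswap]
  have h2 : ∫ t in Ioi (0 : ℝ), ∫ x : E d,
      Real.fourierChar (-inner ℝ x ξ) • (subordinand d a κ t x : ℂ)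
      = ∫ t in Ioi (0 : ℝ),
        ((t ^ (a - 1) * exp (-((κ ^ 2 + 4 * π ^ 2 * ‖ξ‖ ^ 2) * t)) : ℝ) : ℂ) := by
    refine setIntegral_congr_fun measurableSet_Ioi fun t ht ↦ ?_
    have h3 := fourier_heatKernel (d := d) ht ξ
    rw [Real.fourier_eq] at h3
    have h4 : ∀ x : E d, Real.fourierChar (-inner ℝ x ξ) • (subordinand d a κ t x : ℂ)
        = ((t ^ (a - 1) * exp (-(κ ^ 2 * t)) : ℝ) : ℂ) *
          (Real.fourierChar (-inner ℝ x ξ) • (heatKernel d t x : ℂ)) := by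
      intro x
      simp only [subordinand, Circle.smul_def, smul_eq_mul]
      push_cast
      ring
    simp_rw [h4]
    rw [integral_const_mul, h3]
    norm_cast
    rw [mul_assoc, ← exp_add]
    congr 2
    ring
  rw [h2, integral_complex_ofReal, integral_rpow_mul_exp_neg_mul_Ioi ha hr, one_div,
    inv_rpow hr.le, rpow_neg hr.le, ← Complex.ofReal_inv, ← Complex.ofReal_mul]
  congr 1
  have := (Gamma_pos_of_pos ha).ne'
  field_simp

end BesselKernel

/-- Minkowski's integral inequality for the exponent `2`. -/
theorem lintegral_sq_lintegral_le {S T : Type*} [MeasurableSpace S] [MeasurableSpace T]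
    {ν : Measure S} {μ : Measure T} [SFinite ν] [SFinite μ] {F : S → T → ENNReal}
    (hF : Measurable (Function.uncurry F)) :
    ∫⁻ x, (∫⁻ t, F t x ∂ν) ^ 2 ∂μ ≤ (∫⁻ t, (∫⁻ x, F t x ^ 2 ∂μ) ^ (1 / 2 : ℝ) ∂ν) ^ 2 := by
  have hF1 (t : S) : Measurable (F t) := hF.comp measurable_prodMk_left
  have hF2 (x : T) : Measurable (fun t ↦ F t x) := hF.comp measurable_prodMk_right
  have hm : Measurable fun t ↦ (∫⁻ x, F t x ^ 2 ∂μ) ^ (1 / 2 : ℝ) :=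
    (Measurable.lintegral_prod_right' (f := fun p : S × T ↦ F p.1 p.2 ^ 2)
      (hF.pow_const 2)).pow_const _
  have h1 : ∀ x, (∫⁻ t, F t x ∂ν) ^ 2 = ∫⁻ t, ∫⁻ u, F t x * F u x ∂ν ∂ν := by
    intro x
    simp_rw [lintegral_const_mul _ (hF2 x)]
    rw [lintegral_mul_const _ (hF2 x), sq]
  have hm3 : Measurable fun p : T × S × S ↦ F p.2.1 p.1 * F p.2.2 p.1 := by
    refine (hF.comp (f := fun p : T × S × S ↦ (p.2.1, p.1)) (by fun_prop)).mul
      (hF.comp (f := fun p : T × S × S ↦ (p.2.2, p.1)) (by fun_prop))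
  simp_rw [h1]
  rw [lintegral_lintegral_swap]
  swap
  · exact (Measurable.lintegral_prod_right' (f := fun q : (T × S) × S ↦
      F q.1.2 q.1.1 * F q.2 q.1.1) (hm3.comp (f := fun q : (T × S) × S ↦ (q.1.1, q.1.2, q.2))
        (by fun_prop))).aemeasurable
  calc ∫⁻ t, ∫⁻ x, ∫⁻ u, F t x * F u x ∂ν ∂μ ∂ν
      = ∫⁻ t, ∫⁻ u, ∫⁻ x, F t x * F u x ∂μ ∂ν ∂ν := by
        congr 1
        funext t
        refine lintegral_lintegral_swap ?_
        exact (hm3.comp (f := fun q : T × S ↦ (q.1, t, q.2)) (by fun_prop)).aemeasurable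
    _ ≤ ∫⁻ t, ∫⁻ u, (∫⁻ x, F t x ^ 2 ∂μ) ^ (1 / 2 : ℝ) * (∫⁻ x, F u x ^ 2 ∂μ) ^ (1 / 2 : ℝ)
          ∂ν ∂ν := by
        refine lintegral_mono fun t ↦ lintegral_mono fun u ↦ ?_
        have h := ENNReal.lintegral_mul_le_Lp_mul_Lq μ Real.HolderConjugate.two_two
          (hF1 t).aemeasurable (hF1 u).aemeasurable
        simpa using h
    _ = _ := by
        simp_rw [lintegral_const_mul _ hm]
        rw [lintegral_mul_const _ hm, sq]

/-! ### The Matérn function as a Bessel kernel, and its square integrability. -/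

section Matern

variable {d : ℕ}

/-- Substitute `t = b u` with `b = ‖x‖/(2κ)`: this balances `κ²t` and `‖x‖²/(4t)`, which become
`κ‖x‖/2` times `u` and `1/u`. -/
theorem integral_subordinand_of_ne_zero {a η κ : ℝ} (hκ : 0 < κ) (hη : η = a - d / 2) {x : E d}
    (hx : x ≠ 0) :
    ∫ t in Ioi (0 : ℝ), subordinand d a κ t x
      = (4 * π) ^ (-(d : ℝ) / 2) * (κ * ‖x‖ / (2 * κ ^ 2)) ^ η *
        (2 * macdonaldK η (κ * ‖x‖)) := by
  have hr : 0 < ‖x‖ := norm_pos_iff.mpr hx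
  set b := κ * ‖x‖ / (2 * κ ^ 2) with hb
  have hb0 : 0 < b := by positivity
  have h := integral_comp_mul_left_Ioi (fun t ↦ subordinand d a κ t x) 0 hb0
  rw [mul_zero, smul_eq_mul, eq_inv_mul_iff_mul_eq₀ hb0.ne'] at h
  rw [← h, macdonaldK, ← mul_assoc 2, mul_one_div_cancel two_ne_zero, one_mul,
    ← integral_const_mul, ← integral_const_mul]
  refine setIntegral_congr_fun measurableSet_Ioi fun u hu ↦ ?_
  have hu : 0 < u := hu
  simp only [subordinand, heatKernel]
  have h1 : κ ^ 2 * (b * u) = κ * ‖x‖ / 2 * u := by rw [hb]; field_simp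
  have h2 : 1 / (4 * (b * u)) * ‖x‖ ^ 2 = κ * ‖x‖ / 2 * (1 / u) := by rw [hb]; field_simp; ring
  have h3 : (4 * π * (b * u)) ^ (-(d : ℝ) / 2)
      = (4 * π) ^ (-(d : ℝ) / 2) * (b ^ (-(d : ℝ) / 2) * u ^ (-(d : ℝ) / 2)) := by
    rw [mul_rpow (by positivity) (by positivity), mul_rpow hb0.le hu.le]
  have h4 : b ^ η = b * (b ^ (a - 1) * b ^ (-(d : ℝ) / 2)) := by
    rw [← rpow_add hb0, show a - 1 + -(d : ℝ) / 2 = η - 1 by rw [hη]; ring, rpow_sub_one hb0.ne']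
    field_simp
  have h5 : u ^ (η - 1) = u ^ (a - 1) * u ^ (-(d : ℝ) / 2) := by
    rw [← rpow_add hu]
    congr 1; rw [hη]; ring
  rw [h3, mul_rpow hb0.le hu.le, neg_mul, h2, h1, h4, h5, neg_mul, mul_add, neg_add, exp_add]
  ring

theorem maternCov_eq_besselKernel {α η κ σ : ℝ} (hκ : 0 < κ)
    (hη : η = (α - d) / 2) {s t : E d} (hst : s ≠ t) :
    maternCov η κ σ s t = σ ^ 2 * besselKernel d (α / 2) κ (s - t) := by
  have hx : s - t ≠ 0 := sub_ne_zero.mpr hst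
  have hr : 0 < ‖s - t‖ := norm_pos_iff.mpr hx
  have hκr : κ * ‖s - t‖ ≠ 0 := by positivity
  rw [maternCov, powMacdonald, if_neg hκr, besselKernel,
    integral_subordinand_of_ne_zero (η := η) hκ (by rw [hη]; ring) hx,
    div_rpow (by positivity) (by positivity), mul_rpow two_pos.le (by positivity),
    ← rpow_natCast_mul hκ.le, rpow_sub two_pos, rpow_one, neg_div, rpow_neg (by positivity),
    show η + d / 2 = α / 2 by rw [hη]; ring]
  norm_num
  field_simp

theorem maternCov_comm (η κ σ : ℝ) (s t : E d) : maternCov η κ σ s t = maternCov η κ σ t s := by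
  rw [maternCov, maternCov, norm_sub_rev]

theorem maternCov_add_right (η κ σ : ℝ) (s t h : E d) :
    maternCov η κ σ (s + h) t = maternCov η κ σ s (t - h) := by
  rw [maternCov, maternCov]
  congr 4
  abel

/-- The diagonal value, a mere convention for `η ≤ 0`, is harmless because points are null; this is
where `0 < d` matters. -/
theorem ae_maternCov_eq (hd : 0 < d) {α η κ σ : ℝ} (hκ : 0 < κ)
    (hη : η = (α - d) / 2) (s : E d) :
    ∀ᵐ t, maternCov η κ σ s t = σ ^ 2 * besselKernel d (α / 2) κ (s - t) := by
  have : Nonempty (Fin d) := ⟨⟨0, hd⟩⟩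
  filter_upwards [Measure.ae_ne volume s] with t ht
  exact maternCov_eq_besselKernel hκ hη ht.symm

/-- The heat kernel has `L²` norm `(8πt)^{-d/4}`. The value is kept as a square so that its root can
be read off. -/
theorem lintegral_subordinand_sq {a κ : ℝ} {t : ℝ} (ht : 0 < t) :
    ∫⁻ x, ENNReal.ofReal (subordinand d a κ t x) ^ 2
      = ENNReal.ofReal (((8 * π) ^ (-(d : ℝ) / 4) *
        (t ^ (a - d / 4 - 1) * exp (-(κ ^ 2 * t)))) ^ 2) := by
  have h1 : ∀ x : E d, ENNReal.ofReal (subordinand d a κ t x) ^ 2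
      = ENNReal.ofReal ((t ^ (a - 1) * exp (-(κ ^ 2 * t)) * (4 * π * t) ^ (-(d : ℝ) / 2)) ^ 2 *
        exp (-(1 / (2 * t)) * ‖x‖ ^ 2)) := by
    intro x
    rw [← ENNReal.ofReal_pow (subordinand_nonneg a κ ht x), subordinand, heatKernel, ← mul_assoc,
      mul_pow _ (exp _) 2, ← exp_nat_mul]
    congr 3
    push_cast
    field_simp
    norm_num
  simp_rw [h1]
  rw [← ofReal_integral_eq_lintegral_ofReal
    ((integrable_exp_neg_mul_norm_sq (by positivity)).const_mul _)
    (Filter.Eventually.of_forall fun x ↦ by positivity), integral_const_mul,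
    GaussianFourier.integral_rexp_neg_mul_sq_norm (by positivity), finrank_euclideanSpace_fin]
  congr 1
  have h2 : (π / (1 / (2 * t))) ^ ((d : ℝ) / 2) = ((2 * π * t) ^ ((d : ℝ) / 4)) ^ 2 := by
    rw [← rpow_mul_natCast (by positivity)]
    congr 1
    · field_simp
    · push_cast; ring
  rw [h2, ← mul_pow]
  congr 1
  -- Both factors become powers with exponent `-d/4`, with bases `(4πt)²` and `(2πt)⁻¹`, whose
  -- product is `8πt`.
  have h3 : (4 * π * t) ^ (-(d : ℝ) / 2) * (2 * π * t) ^ ((d : ℝ) / 4)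
      = (8 * π) ^ (-(d : ℝ) / 4) * t ^ (-(d : ℝ) / 4) := by
    rw [show -(d : ℝ) / 2 = 2 * (-(d : ℝ) / 4) by ring, rpow_mul (by positivity),
      show (d : ℝ) / 4 = (-1) * (-(d : ℝ) / 4) by ring, rpow_mul (by positivity),
      ← mul_rpow (by positivity) (by positivity), rpow_two, rpow_neg_one,
      ← mul_rpow (by positivity) (by positivity)]
    congr 1
    field_simp
    norm_num
  have h4 : t ^ (a - d / 4 - 1) = t ^ (a - 1) * t ^ (-(d : ℝ) / 4) := by
    rw [← rpow_add ht]
    congr 1; ring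
  rw [h4, mul_assoc _ _ ((2 * π * t) ^ _), h3]
  ring

/-- Minkowski bounds the `L²` norm by a multiple of `∫ t^{a-d/4-1} e^{-κ²t} dt`, convergent at `0`
because `a > d/4`. -/
theorem memLp_two_besselKernel {a κ : ℝ} (ha : (d : ℝ) / 4 < a) (hκ : 0 < κ) :
    MemLp (besselKernel d a κ) 2 := by
  have ha0 : 0 < a := lt_of_le_of_lt (by positivity) ha
  have hsm := (integrable_besselKernel (d := d) ha0 hκ).aestronglyMeasurable
  refine ⟨hsm, ?_⟩
  rw [eLpNorm_lt_top_iff_lintegral_rpow_enorm_lt_top two_ne_zero ENNReal.ofNat_ne_top]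
  have hF : Measurable (Function.uncurry fun (t : ℝ) (x : E d) ↦
      ENNReal.ofReal (subordinand d a κ t x)) :=
    (measurable_uncurry_subordinand a κ).ennreal_ofReal
  have hle : ∀ x : E d, ‖besselKernel d a κ x‖ₑ ^ (ENNReal.toReal 2)
      ≤ ‖(Gamma a)⁻¹‖ₑ ^ 2 *
        (∫⁻ t in Ioi (0 : ℝ), ENNReal.ofReal (subordinand d a κ t x)) ^ 2 := by
    intro x
    rw [ENNReal.toReal_ofNat, ENNReal.rpow_two, besselKernel, enorm_mul, mul_pow]
    gcongr
    refine (enorm_integral_le_lintegral_enorm _).trans (le_of_eq ?_)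
    refine setLIntegral_congr_fun measurableSet_Ioi fun t ht ↦ ?_
    exact Real.enorm_of_nonneg (subordinand_nonneg a κ ht x)
  refine (lintegral_mono hle).trans_lt ?_
  rw [lintegral_const_mul' _ _ (by finiteness)]
  refine ENNReal.mul_lt_top (by finiteness) ?_
  refine (lintegral_sq_lintegral_le hF).trans_lt (ENNReal.pow_lt_top ?_)
  have h1 : ∫⁻ t in Ioi (0 : ℝ),
      (∫⁻ x, ENNReal.ofReal (subordinand d a κ t x) ^ 2) ^ (1 / 2 : ℝ)
      = ∫⁻ t in Ioi (0 : ℝ), ENNReal.ofReal ((8 * π) ^ (-(d : ℝ) / 4) *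
        (t ^ (a - d / 4 - 1) * exp (-(κ ^ 2 * t)))) := by
    refine setLIntegral_congr_fun measurableSet_Ioi fun t ht ↦ ?_
    have ht : 0 < t := ht
    rw [lintegral_subordinand_sq ht, ENNReal.ofReal_rpow_of_nonneg (by positivity) (by norm_num),
      ← Real.sqrt_eq_rpow, Real.sqrt_sq (by positivity)]
  rw [h1]
  exact (((integrable_rpow_mul_exp (sub_pos.mpr ha) (by positivity : 0 < κ ^ 2)).const_mul
    _).lintegral_lt_top)

end Matern

/-! ### Inversion of the operator and its representation by the Bessel kernel. -/

section FracOp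

variable {d : ℕ}

theorem fourier_complexify_fracOp {κ : ℝ} (hκ : 0 < κ) (β : ℝ) (φ : 𝓢(E d, ℝ)) (ξ : E d) :
    𝓕 (complexify (fracOp κ β φ)) ξ = (symbol d κ β ξ : ℂ) * 𝓕 (complexify φ) ξ :=
  fourier_fracOp hκ β φ ξ

theorem complexify_injective : Function.Injective (complexify (d := d)) := by
  intro φ ψ h
  ext x
  exact Complex.ofReal_injective (congrArg (fun f : 𝓢(E d, ℂ) ↦ f x) h)

theorem fracOp_neg_fracOp {κ : ℝ} (hκ : 0 < κ) (β : ℝ) (φ : 𝓢(E d, ℝ)) :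
    fracOp κ (-β) (fracOp κ β φ) = φ := by
  apply complexify_injective
  have h : 𝓕 (complexify (fracOp κ (-β) (fracOp κ β φ))) = 𝓕 (complexify φ) := by
    ext ξ
    rw [fourier_complexify_fracOp hκ, fourier_complexify_fracOp hκ, ← mul_assoc,
      ← Complex.ofReal_mul, symbol, symbol, ← rpow_add (by positivity)]
    rw [show -β / 2 + β / 2 = 0 by ring, rpow_zero, Complex.ofReal_one, one_mul]
  have h2 := congrArg (fun f : 𝓢(E d, ℂ) ↦ (𝓕⁻ f : 𝓢(E d, ℂ))) h
  simpa only [FourierTransform.fourierInv_fourier_eq] using h2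

theorem fracOp_fracOp_neg {κ : ℝ} (hκ : 0 < κ) (β : ℝ) (φ : 𝓢(E d, ℝ)) :
    fracOp κ β (fracOp κ (-β) φ) = φ := by
  simpa using fracOp_neg_fracOp hκ (-β) φ

theorem continuous_fracOp (κ β : ℝ) : Continuous (fracOp (d := d) κ β) := by
  unfold fracOp complexify
  fun_prop

theorem fracOp_linear (κ β a b : ℝ) (φ ψ : 𝓢(E d, ℝ)) :
    fracOp κ β (a • φ + b • ψ) = a • fracOp κ β φ + b • fracOp κ β ψ := by
  have h (φ : 𝓢(E d, ℝ)) (a : ℝ) : complexify (a • φ) = (a : ℂ) • complexify φ := by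
    ext x
    simp [complexify]
  have h2 (F : 𝓢(E d, ℂ)) (a : ℝ) : SchwartzMap.postcompCLM (𝕜 := ℝ) Complex.reCLM ((a : ℂ) • F)
      = a • SchwartzMap.postcompCLM (𝕜 := ℝ) Complex.reCLM F := by
    ext x
    simp
  have h3 : complexify (a • φ + b • ψ) = (a : ℂ) • complexify φ + (b : ℂ) • complexify ψ := by
    rw [← h, ← h]
    exact map_add _ _ _
  simp only [fracOp, h3, map_add, map_smul, h2]

/-- `(κ² - Δ)^{-α/2}` is the convolution with the Bessel kernel. -/
theorem fracOp_neg_eq_integral {κ α : ℝ} (hκ : 0 < κ) (hα : 0 < α) (ψ : 𝓢(E d, ℝ)) (s : E d) :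
    fracOp κ (-α) ψ s = ∫ t, besselKernel d (α / 2) κ (s - t) * ψ t := by
  have hα2 : 0 < α / 2 := by positivity
  set g : E d → ℂ := fun x ↦ (besselKernel d (α / 2) κ x : ℂ) with hg
  have hgi : Integrable g := (integrable_besselKernel hα2 hκ).ofReal
  -- Chosen so that its Fourier transform is `x ↦ ψ (s - x)`. The identity `∫ ĝ h = ∫ g ĥ` then
  -- yields the convolution without inverting `ĝ`, which need not be integrable.
  set h : E d → ℂ := fun v ↦ (Real.fourierChar (inner ℝ v s)) • 𝓕 (complexify ψ) v with hh
  have hhi : Integrable h := by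
    have hi : Integrable (𝓕 (complexify ψ) : 𝓢(E d, ℂ)) := SchwartzMap.integrable _
    refine hi.mono (Continuous.aestronglyMeasurable ?_)
      (Filter.Eventually.of_forall fun v ↦ by simp [hh, Circle.norm_smul])
    exact Continuous.smul (by fun_prop) (SchwartzMap.continuous _)
  have hflip : ∫ ξ, 𝓕 g ξ • h ξ = ∫ x, g x • 𝓕 h x := by
    simpa using! VectorFourier.integral_fourierIntegral_smul_eq_flip (L := innerₗ (E d))
      Real.continuous_fourierChar continuous_inner hgi hhi
  have hFh (x : E d) : 𝓕 h x = (ψ (s - x) : ℂ) := by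
    have h1 : (ψ (s - x) : ℂ) = 𝓕⁻ (𝓕 (complexify ψ)) (s - x) := by
      rw [FourierTransform.fourierInv_fourier_eq]
      rfl
    rw [h1, SchwartzMap.fourierInv_coe, Real.fourierInv_eq, Real.fourier_eq]
    congr 1
    funext v
    rw [hh, smul_smul, ← AddChar.map_add_eq_mul, inner_sub_right, neg_add_eq_sub]
  have hL : (fracOp κ (-α) ψ s : ℂ) = ∫ ξ, 𝓕 g ξ • h ξ := by
    have h1 : (fracOp κ (-α) ψ s : ℂ) = 𝓕⁻ (𝓕 (complexify (fracOp κ (-α) ψ))) s := by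
      rw [FourierTransform.fourierInv_fourier_eq]
      rfl
    rw [h1, SchwartzMap.fourierInv_coe, Real.fourierInv_eq]
    congr 1
    funext v
    rw [fourier_complexify_fracOp hκ, hg, fourier_besselKernel hα2 hκ, symbol, neg_div, hh]
    simp only [Circle.smul_def, smul_eq_mul]
    ring
  rw [hflip] at hL
  simp_rw [hFh, hg, smul_eq_mul, ← Complex.ofReal_mul] at hL
  rw [integral_complex_ofReal, Complex.ofReal_inj] at hL
  rw [hL, ← integral_sub_left_eq_self _ _ s]
  simp

theorem fracOp_neg_compSubConst {κ α : ℝ} (hκ : 0 < κ) (hα : 0 < α) (ψ : 𝓢(E d, ℝ)) (h s : E d) :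
    fracOp κ (-α) (SchwartzMap.compSubConstCLM ℝ h ψ) s = fracOp κ (-α) ψ (s - h) := by
  rw [fracOp_neg_eq_integral hκ hα, fracOp_neg_eq_integral hκ hα,
    ← integral_sub_right_eq_self (fun t ↦ besselKernel d (α / 2) κ (s - h - t) * ψ t) h]
  congr 1
  funext t
  rw [SchwartzMap.compSubConstCLM_apply]
  congr 2
  abel

end FracOp

/-! ### Transfer from the Bessel kernel to the Matérn function. -/

section Potential

variable {d : ℕ} {α κ σ η : ℝ}

theorem integrable_maternCov (hd : 0 < d) (hα : 0 < α) (hκ : 0 < κ) (hη : η = (α - d) / 2)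
    (s : E d) : Integrable (fun t ↦ maternCov η κ σ s t) := by
  refine Integrable.congr ?_ ((ae_maternCov_eq (σ := σ) hd hκ hη s).mono fun _ h ↦ h.symm)
  exact ((integrable_besselKernel (by positivity) hκ).comp_sub_left s).const_mul _

theorem memLp_two_maternCov (hd : 0 < d) (hα : (d : ℝ) / 2 < α) (hκ : 0 < κ)
    (hη : η = (α - d) / 2) (s : E d) :
    MemLp (fun t ↦ maternCov η κ σ s t) 2 (volume : Measure (E d)) := by
  refine MemLp.ae_eq ((ae_maternCov_eq (σ := σ) hd hκ hη s).mono fun _ h ↦ h.symm) ?_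
  exact ((memLp_two_besselKernel (by linarith) hκ).comp_measurePreserving
    (Measure.measurePreserving_sub_left volume s)).const_mul _

theorem fourier_maternCov (hd : 0 < d) (hα : 0 < α) (hκ : 0 < κ) (hσ : 0 < σ)
    (hη : η = (α - d) / 2) (ξ : E d) :
    𝓕 (fun x : E d ↦ (((σ ^ 2)⁻¹ * maternCov η κ σ x 0 : ℝ) : ℂ)) ξ
      = (((κ ^ 2 + 4 * π ^ 2 * ‖ξ‖ ^ 2) ^ (-α / 2) : ℝ) : ℂ) := by
  rw [neg_div, ← fourier_besselKernel (by positivity) hκ, Real.fourier_eq, Real.fourier_eq]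
  refine integral_congr_ae ?_
  have : Nonempty (Fin d) := ⟨⟨0, hd⟩⟩
  filter_upwards [Measure.ae_ne volume (0 : E d)] with x hx
  rw [maternCov_eq_besselKernel hκ hη hx, sub_zero, inv_mul_cancel_left₀ (by positivity)]

theorem integrable_maternCov_mul (hd : 0 < d) (hα : 0 < α) (hκ : 0 < κ)
    (hη : η = (α - d) / 2) (ψ : 𝓢(E d, ℝ)) (s : E d) :
    Integrable (fun t ↦ maternCov η κ σ s t * ψ t) := by
  refine (integrable_maternCov hd hα hκ hη s).mul_bdd (c := ‖ψ.toBoundedContinuousFunction‖)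
    ψ.continuous.aestronglyMeasurable (Filter.Eventually.of_forall fun x ↦ ?_)
  exact ψ.toBoundedContinuousFunction.norm_coe_le_norm x

theorem integral_maternCov_mul (hd : 0 < d) (hα : 0 < α) (hκ : 0 < κ)
    (hη : η = (α - d) / 2) (ψ : 𝓢(E d, ℝ)) (s : E d) :
    ∫ t, maternCov η κ σ s t * ψ t = σ ^ 2 * fracOp κ (-α) ψ s := by
  rw [fracOp_neg_eq_integral hκ hα, ← integral_const_mul]
  refine integral_congr_ae ?_
  filter_upwards [ae_maternCov_eq (σ := σ) hd hκ hη s] with t ht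
  rw [ht, mul_assoc]

theorem integral_maternCov_mul_left (hd : 0 < d) (hα : 0 < α) (hκ : 0 < κ)
    (hη : η = (α - d) / 2) (ψ : 𝓢(E d, ℝ)) (t : E d) :
    ∫ s, maternCov η κ σ s t * ψ s = σ ^ 2 * fracOp κ (-α) ψ t := by
  simp_rw [maternCov_comm η κ σ _ t]
  exact integral_maternCov_mul hd hα hκ hη ψ t

end Potential

/-! ### White noise as an isometry, and its joint laws. -/

section WhiteNoise

variable {Ω : Type*} [MeasurableSpace Ω] {P : Measure Ω} {d : ℕ}
  {W : Lp ℝ 2 (volume : Measure (E d)) → Ω → ℝ}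

/-- A map between real inner product spaces that preserves inner products is linear. -/
theorem map_add_smul_of_inner_map {H K : Type*} [NormedAddCommGroup H] [InnerProductSpace ℝ H]
    [NormedAddCommGroup K] [InnerProductSpace ℝ K] (G : H → K)
    (hG : ∀ f g, inner ℝ (G f) (G g) = inner ℝ f g) (a b : ℝ) (f g : H) :
    G (a • f + b • g) = a • G f + b • G g := by
  -- The squared norm of the defect expands into inner products of values of `G`; replaced by those
  -- of the arguments, they cancel.
  rw [← sub_eq_zero, ← inner_self_eq_zero (𝕜 := ℝ)]
  simp only [inner_sub_left, inner_sub_right, inner_add_left, inner_add_right, inner_smul_left,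
    inner_smul_right, hG]
  ring

theorem IsWhiteNoise.aemeasurable (hW : IsWhiteNoise W P) (f : Lp ℝ 2 (volume : Measure (E d))) :
    AEMeasurable (W f) P :=
  hW.gaussian.aemeasurable f

theorem IsWhiteNoise.memLp (hW : IsWhiteNoise W P) (f : Lp ℝ 2 (volume : Measure (E d))) :
    MemLp (W f) 2 P :=
  (hW.gaussian.hasGaussianLaw_eval f).memLp_two

theorem IsWhiteNoise.inner_toLp (hW : IsWhiteNoise W P)
    (f g : Lp ℝ 2 (volume : Measure (E d))) :
    inner ℝ ((hW.memLp f).toLp (W f)) ((hW.memLp g).toLp (W g)) = inner ℝ f g := by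
  rw [← hW.cov f g, L2.inner_def]
  refine integral_congr_ae ?_
  filter_upwards [(hW.memLp f).coeFn_toLp, (hW.memLp g).coeFn_toLp] with ω h1 h2
  rw [h1, h2]
  simp [mul_comm]

/-- White noise as a linear isometry of `L²(ℝ^d)` into `L²(P)`. -/
noncomputable def IsWhiteNoise.isometry (hW : IsWhiteNoise W P) :
    Lp ℝ 2 (volume : Measure (E d)) →ₗᵢ[ℝ] Lp ℝ 2 P where
  toFun f := (hW.memLp f).toLp (W f)
  map_add' f g := by
    simpa using map_add_smul_of_inner_map (fun f ↦ (hW.memLp f).toLp (W f)) hW.inner_toLp 1 1 f g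
  map_smul' a f := by
    simpa using map_add_smul_of_inner_map (fun f ↦ (hW.memLp f).toLp (W f)) hW.inner_toLp a 0 f 0
  norm_map' f := by
    simp only [LinearMap.coe_mk, AddHom.coe_mk]
    rw [← sq_eq_sq₀ (norm_nonneg _) (norm_nonneg _), ← real_inner_self_eq_norm_sq,
      ← real_inner_self_eq_norm_sq, hW.inner_toLp]

theorem IsWhiteNoise.coeFn_isometry (hW : IsWhiteNoise W P)
    (f : Lp ℝ 2 (volume : Measure (E d))) : hW.isometry f =ᵐ[P] W f :=
  (hW.memLp f).coeFn_toLp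

theorem IsWhiteNoise.ae_map_smul (hW : IsWhiteNoise W P) (a : ℝ)
    (f : Lp ℝ 2 (volume : Measure (E d))) : ∀ᵐ ω ∂P, W (a • f) ω = a * W f ω := by
  filter_upwards [hW.coeFn_isometry (a • f), hW.coeFn_isometry f,
    Lp.coeFn_smul a (hW.isometry f)] with ω h1 h2 h3
  rw [← h1, ← h2, map_smul, h3]
  simp

theorem IsWhiteNoise.ae_map_add (hW : IsWhiteNoise W P)
    (f g : Lp ℝ 2 (volume : Measure (E d))) : ∀ᵐ ω ∂P, W (f + g) ω = W f ω + W g ω := by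
  filter_upwards [hW.coeFn_isometry (f + g), hW.coeFn_isometry f, hW.coeFn_isometry g,
    Lp.coeFn_add (hW.isometry f) (hW.isometry g)] with ω h1 h2 h3 h4
  rw [← h1, ← h2, ← h3, map_add, h4]
  simp

theorem IsWhiteNoise.ae_map_sum (hW : IsWhiteNoise W P) {ι : Type*} (s : Finset ι) (a : ι → ℝ)
    (f : ι → Lp ℝ 2 (volume : Measure (E d))) :
    ∀ᵐ ω ∂P, W (∑ i ∈ s, a i • f i) ω = ∑ i ∈ s, a i * W (f i) ω := by
  classical
  induction s using Finset.induction_on with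
  | empty =>
    filter_upwards [hW.ae_map_smul 0 0] with ω h
    simpa using h
  | insert i s hi ih =>
    filter_upwards [ih, hW.ae_map_add (a i • f i) (∑ i ∈ s, a i • f i),
      hW.ae_map_smul (a i) (f i)] with ω h1 h2 h3
    rw [Finset.sum_insert hi, Finset.sum_insert hi, h2, h1, h3]

theorem IsWhiteNoise.eLpNorm_sub (hW : IsWhiteNoise W P)
    (f g : Lp ℝ 2 (volume : Measure (E d))) :
    eLpNorm (fun ω ↦ W f ω - W g ω) 2 P = ENNReal.ofReal ‖f - g‖ := by
  rw [← hW.isometry.norm_map, map_sub, Lp.norm_def,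
    ENNReal.ofReal_toReal (Lp.eLpNorm_ne_top _)]
  refine eLpNorm_congr_ae ?_
  filter_upwards [hW.coeFn_isometry f, hW.coeFn_isometry g,
    Lp.coeFn_sub (hW.isometry f) (hW.isometry g)] with ω h1 h2 h3
  rw [h3, Pi.sub_apply, h1, h2]

theorem IsWhiteNoise.map_eq (hW : IsWhiteNoise W P) (f : Lp ℝ 2 (volume : Measure (E d))) :
    P.map (W f) = gaussianReal 0 (‖f‖ ^ 2).toNNReal := by
  have := hW.gaussian.isProbabilityMeasure
  rw [(hW.gaussian.hasGaussianLaw_eval f).map_eq_gaussianReal, hW.mean f,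
    variance_of_integral_eq_zero (hW.aemeasurable f) (hW.mean f), ← real_inner_self_eq_norm_sq,
    ← hW.cov f f]
  simp [sq]

/-- The joint law of a finite family of Wiener integrals depends only on the Gram matrix. -/
theorem IsWhiteNoise.identDistrib (hW : IsWhiteNoise W P) {ι : Type*} [Fintype ι]
    {f g : ι → Lp ℝ 2 (volume : Measure (E d))}
    (h : ∀ i j, inner ℝ (f i) (f j) = inner ℝ (g i) (g j)) :
    IdentDistrib (fun ω i ↦ W (f i) ω) (fun ω i ↦ W (g i) ω) P P := by
  classical
  have := hW.gaussian.isProbabilityMeasure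
  have hm (f : ι → Lp ℝ 2 (volume : Measure (E d))) : AEMeasurable (fun ω i ↦ W (f i) ω) P :=
    aemeasurable_pi_lambda _ fun i ↦ hW.aemeasurable (f i)
  refine ⟨hm f, hm g, ?_⟩
  have := Measure.isProbabilityMeasure_map (hm f)
  have := Measure.isProbabilityMeasure_map (hm g)
  refine Measure.ext_of_charFunDual ?_
  -- Cramér–Wold: a linear functional of the vector is a.s. `W` of one linear combination, hence a
  -- centred Gaussian whose variance is a quadratic form in the Gram matrix.
  have key (L : StrongDual ℝ (ι → ℝ)) (f : ι → Lp ℝ 2 (volume : Measure (E d))) :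
      (P.map (fun ω i ↦ W (f i) ω)).map L
        = gaussianReal 0 (‖∑ i, L (Pi.single i 1) • f i‖ ^ 2).toNNReal := by
    rw [AEMeasurable.map_map_of_aemeasurable (by fun_prop) (hm f), ← hW.map_eq]
    refine Measure.map_congr ?_
    filter_upwards [hW.ae_map_sum Finset.univ (fun i ↦ L (Pi.single i 1)) f] with ω hω
    rw [hω, Function.comp_apply]
    conv_lhs => rw [← Finset.univ_sum_single (fun i ↦ W (f i) ω), map_sum]
    refine Finset.sum_congr rfl fun i _ ↦ ?_
    rw [mul_comm, ← smul_eq_mul, ← map_smul, ← Pi.single_smul, smul_eq_mul, mul_one]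
  ext L
  rw [charFunDual_eq_charFun_map_one, charFunDual_eq_charFun_map_one, key, key]
  congr 2
  rw [← real_inner_self_eq_norm_sq, ← real_inner_self_eq_norm_sq]
  simp only [sum_inner, inner_sum, inner_smul_left, inner_smul_right, h]

end WhiteNoise

theorem wienerIntegral_of_memLp {Ω : Type*} {d : ℕ}
    {W : Lp ℝ 2 (volume : Measure (E d)) → Ω → ℝ} {f : E d → ℝ}
    (hf : MemLp f 2 (volume : Measure (E d))) :
    wienerIntegral W f = W hf.toLp := by
  simp [wienerIntegral, hf]

/-! ### Bochner integrals of `L²`-valued functions, read pointwise. -/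

section LpIntegral

variable {S T : Type*} [MeasurableSpace S] [MeasurableSpace T] {ν : Measure S} {μ : Measure T}
  {K : S → T → ℝ} {Φ : S → Lp ℝ 2 μ}

theorem setIntegral_norm_le_norm_Lp (A : Set T) (hA : μ A ≠ ⊤) (f : Lp ℝ 2 μ) :
    IntegrableOn f A μ ∧ ∫ t in A, ‖f t‖ ∂μ ≤ μ.real A ^ (1 / 2 : ℝ) * ‖f‖ := by
  have : IsFiniteMeasure (μ.restrict A) := ⟨by simpa using hA.lt_top⟩
  have h2 : MemLp f 2 (μ.restrict A) := (Lp.memLp f).restrict A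
  have hi : IntegrableOn f A μ := h2.integrable one_le_two
  refine ⟨hi, ?_⟩
  rw [integral_norm_eq_lintegral_enorm hi.aestronglyMeasurable, ← eLpNorm_one_eq_lintegral_enorm,
    Lp.norm_def, mul_comm]
  have h := eLpNorm_le_eLpNorm_mul_rpow_measure_univ (one_le_two : (1 : ENNReal) ≤ 2)
    hi.aestronglyMeasurable
  have h' : eLpNorm f 1 (μ.restrict A) ≤ eLpNorm f 2 μ * μ A ^ (1 / 2 : ℝ) := by
    refine h.trans ?_
    gcongr
    · exact Measure.restrict_le_self
    · refine le_of_eq ?_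
      norm_num
  refine (ENNReal.toReal_mono ?_ h').trans (le_of_eq ?_)
  · exact ENNReal.mul_ne_top (Lp.eLpNorm_ne_top f) (ENNReal.rpow_ne_top_of_nonneg (by norm_num) hA)
  · rw [ENNReal.toReal_mul, ← ENNReal.toReal_rpow, Measure.real]

/-- On a set of finite measure `L²` embeds into `L¹`, so Fubini applies there even if `K` is not
integrable on the whole product. -/
theorem integrable_prod_restrict_of_integrable_Lp [SFinite ν] [SFinite μ]
    (hK : AEStronglyMeasurable (Function.uncurry K) (ν.prod μ)) (hΦ : Integrable Φ ν)
    (h : ∀ s, Φ s =ᵐ[μ] K s) (A : Set T) (hA : μ A ≠ ⊤) :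
    Integrable (Function.uncurry K) (ν.prod (μ.restrict A)) := by
  have hm : AEStronglyMeasurable (Function.uncurry K) (ν.prod (μ.restrict A)) :=
    hK.mono_ac (Measure.AbsolutelyContinuous.rfl.prod Measure.restrict_le_self.absolutelyContinuous)
  rw [integrable_prod_iff hm]
  have hA' (s : S) : Φ s =ᵐ[μ.restrict A] K s := ae_restrict_of_ae (h s)
  refine ⟨Filter.Eventually.of_forall fun s ↦
    (setIntegral_norm_le_norm_Lp A hA (Φ s)).1.congr (hA' s), ?_⟩
  refine (hΦ.norm.const_mul (μ.real A ^ (1 / 2 : ℝ))).mono' hm.norm.integral_prod_right'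
    (Filter.Eventually.of_forall fun s ↦ ?_)
  rw [Real.norm_of_nonneg (integral_nonneg fun _ ↦ norm_nonneg _)]
  refine le_trans (le_of_eq ?_) (setIntegral_norm_le_norm_Lp A hA (Φ s)).2
  refine integral_congr_ae ?_
  filter_upwards [hA' s] with t ht
  simp [Function.uncurry, ht]

/-- The sections of a representing kernel of an integrable `L²`-valued function are integrable. -/
theorem ae_integrable_of_integrable_Lp [SFinite ν] [SigmaFinite μ]
    (hK : AEStronglyMeasurable (Function.uncurry K) (ν.prod μ)) (hΦ : Integrable Φ ν)
    (h : ∀ s, Φ s =ᵐ[μ] K s) : ∀ᵐ t ∂μ, Integrable (fun s ↦ K s t) ν := by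
  rw [← Measure.restrict_univ (μ := μ), ← iUnion_spanningSets μ, ae_restrict_iUnion_iff]
  intro n
  exact (integrable_prod_restrict_of_integrable_Lp hK hΦ h _
    (measure_spanningSets_lt_top μ n).ne).prod_left_ae

/-- The Bochner integral of an `L²`-valued function is computed pointwise. -/
theorem coeFn_integral_Lp [SFinite ν] [SigmaFinite μ]
    (hK : AEStronglyMeasurable (Function.uncurry K) (ν.prod μ)) (hΦ : Integrable Φ ν)
    (h : ∀ s, Φ s =ᵐ[μ] K s) : (∫ s, Φ s ∂ν : Lp ℝ 2 μ) =ᵐ[μ] fun t ↦ ∫ s, K s t ∂ν := by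
  have hint (A : Set T) (hA : μ A < ⊤) :=
    integrable_prod_restrict_of_integrable_Lp hK hΦ h A hA.ne
  refine ae_eq_of_forall_setIntegral_eq_of_sigmaFinite
    (fun A _ hA ↦ (setIntegral_norm_le_norm_Lp A hA.ne _).1)
    (fun A _ hA ↦ (hint A hA).integral_prod_right) fun A hmA hA ↦ ?_
  -- Integration over `A` is a continuous functional on `L²`, so it commutes with the Bochner
  -- integral; Fubini on `A` does the rest.
  have h1 (f : Lp ℝ 2 μ) : ∫ t in A, f t ∂μ = inner ℝ (indicatorConstLp 2 hmA hA.ne (1 : ℝ)) f :=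
    (L2.inner_indicatorConstLp_one hmA hA.ne f).symm
  rw [h1, ← integral_inner hΦ]
  simp_rw [← h1]
  rw [← integral_integral_swap (hint A hA)]
  refine integral_congr_ae (Filter.Eventually.of_forall fun s ↦ ?_)
  exact integral_congr_ae (ae_restrict_of_ae (h s))

end LpIntegral

/-- A continuous map into `L²` has a jointly measurable representative. -/
theorem exists_measurable_uncurry_of_continuous {S T : Type*} [TopologicalSpace S]
    [TopologicalSpace.SeparableSpace S] [Nonempty S] [MeasurableSpace S] [OpensMeasurableSpace S]
    [MeasurableSpace T] {μ : Measure T} {Φ : S → Lp ℝ 2 μ} (hΦ : Continuous Φ) :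
    ∃ Z : S → T → ℝ, Measurable (Function.uncurry Z) ∧ ∀ s, Z s =ᵐ[μ] Φ s := by
  classical
  let x : ℕ → S := TopologicalSpace.denseSeq S
  have hex (n : ℕ) (s : S) : ∃ k, ‖Φ (x k) - Φ s‖ ^ 2 < (1 / 2) ^ n := by
    have ho : IsOpen {y | ‖Φ y - Φ s‖ ^ 2 < (1 / 2) ^ n} :=
      isOpen_lt (by fun_prop) continuous_const
    obtain ⟨y, hy, k, rfl⟩ := (TopologicalSpace.denseRange_denseSeq S).inter_open_nonempty _ ho
      ⟨s, by simp⟩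
    exact ⟨k, hy⟩
  -- Taking the first admissible index makes the choice measurable in `s`, each condition being
  -- open.
  let N (n : ℕ) (s : S) : ℕ := Nat.find (hex n s)
  have hN (n : ℕ) : Measurable (N n) :=
    measurable_find _ fun k ↦
      (isOpen_lt (f := fun s ↦ ‖Φ (x k) - Φ s‖ ^ 2) (by fun_prop) continuous_const).measurableSet
  let w (k : ℕ) : T → ℝ := Φ (x k)
  have hw (k : ℕ) : Measurable (w k) := (Lp.stronglyMeasurable _).measurable
  let Y (n : ℕ) (p : S × T) : ℝ := w (N n p.1) p.2
  have hY (n : ℕ) : Measurable (Y n) := by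
    have h1 : Measurable (fun q : ℕ × T ↦ w q.1 q.2) := measurable_from_prod_countable_right hw
    exact h1.comp (((hN n).comp measurable_fst).prodMk measurable_snd)
  -- The limsup is jointly measurable, and equals the limit wherever that exists. For fixed `s` the
  -- squared errors have summable integrals, so convergence holds almost everywhere.
  refine ⟨fun s t ↦ Filter.limsup (fun n ↦ Y n (s, t)) Filter.atTop, Measurable.limsup hY,
    fun s ↦ ?_⟩
  have hbound (n : ℕ) : ∫⁻ t, ‖w (N n s) t - Φ s t‖ₑ ^ 2 ∂μ ≤ ENNReal.ofReal ((1 / 2) ^ n) := by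
    have h1 := Nat.find_spec (hex n s)
    have h2 : ∫⁻ t, ‖w (N n s) t - Φ s t‖ₑ ^ 2 ∂μ
        = ENNReal.ofReal (‖Φ (x (N n s)) - Φ s‖ ^ 2) := by
      rw [ENNReal.ofReal_pow (norm_nonneg _), Lp.norm_def, ENNReal.ofReal_toReal
        (Lp.eLpNorm_ne_top _), eLpNorm_congr_ae (Lp.coeFn_sub _ _)]
      rw [eLpNorm_eq_lintegral_rpow_enorm_toReal two_ne_zero ENNReal.ofNat_ne_top,
        ← ENNReal.rpow_natCast, ← ENNReal.rpow_mul]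
      norm_num
      rfl
    rw [h2]
    exact ENNReal.ofReal_le_ofReal h1.le
  have hme (n : ℕ) : Measurable fun t ↦ ‖w (N n s) t - Φ s t‖ₑ ^ 2 :=
    ((hw _).sub (Lp.stronglyMeasurable _).measurable).enorm.pow_const 2
  have hsum : ∫⁻ t, ∑' n, ‖w (N n s) t - Φ s t‖ₑ ^ 2 ∂μ ≠ ⊤ := by
    rw [lintegral_tsum fun n ↦ (hme n).aemeasurable]
    refine ne_top_of_le_ne_top ?_ (ENNReal.tsum_le_tsum hbound)
    rw [← ENNReal.ofReal_tsum_of_nonneg (fun n ↦ by positivity) summable_geometric_two]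
    exact ENNReal.ofReal_ne_top
  have hae := ae_lt_top (Measurable.tsum fun n ↦ hme n) hsum
  filter_upwards [hae] with t ht
  refine Filter.Tendsto.limsup_eq ?_
  have h1 := ENNReal.tendsto_atTop_zero_of_tsum_ne_top ht.ne
  rw [tendsto_iff_edist_tendsto_0]
  have h2 := h1.ennrpow_const (1 / 2 : ℝ)
  have h0 : (0 : ENNReal) ^ (1 / 2 : ℝ) = 0 := ENNReal.zero_rpow_of_pos (by norm_num)
  rw [h0] at h2
  refine h2.congr fun n ↦ ?_
  rw [← ENNReal.rpow_natCast, ← ENNReal.rpow_mul, edist_eq_enorm_sub]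
  norm_num
  rfl

theorem wienerIntegral_schwartz {Ω : Type*} {d : ℕ}
    {W : Lp ℝ 2 (volume : Measure (E d)) → Ω → ℝ} (φ : 𝓢(E d, ℝ)) :
    wienerIntegral W φ = W (φ.toLp 2) :=
  wienerIntegral_of_memLp (φ.memLp 2)

/-! ### Generalized random fields. -/

section Generalized

variable {Ω : Type*} [MeasurableSpace Ω] {P : Measure Ω} {d : ℕ}
  {W : Lp ℝ 2 (volume : Measure (E d)) → Ω → ℝ} {α κ σ η : ℝ}

theorem IsWhiteNoise.identDistrib_of_ae_eq (hW : IsWhiteNoise W P) {ι : Type*} [Fintype ι]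
    {f g : ι → Lp ℝ 2 (volume : Measure (E d))} {X Y : ι → Ω → ℝ} {c : ℝ}
    (hX : ∀ i, ∀ᵐ ω ∂P, X i ω = c * W (f i) ω) (hY : ∀ i, ∀ᵐ ω ∂P, Y i ω = c * W (g i) ω)
    (h : ∀ i j, inner ℝ (f i) (f j) = inner ℝ (g i) (g j)) :
    IdentDistrib (fun ω i ↦ X i ω) (fun ω i ↦ Y i ω) P P := by
  have h0 := (hW.identDistrib h).comp (u := fun v i ↦ c * v i) (by fun_prop)
  have hX' : ((fun v i ↦ c * v i) ∘ fun ω i ↦ W (f i) ω) =ᵐ[P] fun ω i ↦ X i ω := by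
    filter_upwards [ae_all_iff.2 hX] with ω hω
    funext i
    exact (hω i).symm
  have hY' : ((fun v i ↦ c * v i) ∘ fun ω i ↦ W (g i) ω) =ᵐ[P] fun ω i ↦ Y i ω := by
    filter_upwards [ae_all_iff.2 hY] with ω hω
    funext i
    exact (hω i).symm
  exact ((IdentDistrib.of_ae_eq h0.aemeasurable_fst hX').symm.trans h0).trans
    (IdentDistrib.of_ae_eq h0.aemeasurable_snd hY')

/-- The class in `L²` of the Bessel potential `(κ² - Δ)^{-α/2} ψ` of a test function. -/
noncomputable def potentialLp (κ α : ℝ) (ψ : 𝓢(E d, ℝ)) : Lp ℝ 2 (volume : Measure (E d)) :=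
  (fracOp κ (-α) ψ).toLp 2

theorem continuous_potentialLp (κ α : ℝ) : Continuous (potentialLp (d := d) κ α) :=
  SchwartzMap.continuous_toLp.comp (continuous_fracOp κ (-α))

theorem potentialLp_linear (κ α a b : ℝ) (φ ψ : 𝓢(E d, ℝ)) :
    potentialLp κ α (a • φ + b • ψ) = a • potentialLp κ α φ + b • potentialLp κ α ψ := by
  rw [potentialLp, fracOp_linear]
  rfl

theorem potentialLp_fracOp (hκ : 0 < κ) (φ : 𝓢(E d, ℝ)) :
    potentialLp κ α (fracOp κ α φ) = φ.toLp 2 := by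
  rw [potentialLp, fracOp_neg_fracOp hκ]

theorem inner_potentialLp (κ α : ℝ) (φ ψ : 𝓢(E d, ℝ)) :
    inner ℝ (potentialLp κ α φ) (potentialLp κ α ψ)
      = ∫ x, fracOp κ (-α) φ x * fracOp κ (-α) ψ x := by
  rw [L2.inner_def]
  refine integral_congr_ae ?_
  filter_upwards [(fracOp κ (-α) φ).coeFn_toLp 2, (fracOp κ (-α) ψ).coeFn_toLp 2] with x h1 h2
  rw [potentialLp, potentialLp, h1, h2]
  simp [mul_comm]

/-- The Bessel potential commutes with translations and Lebesgue measure is invariant. Equality of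
Gram matrices is what stationarity requires. -/
theorem inner_potentialLp_compSubConst (hκ : 0 < κ) (hα : 0 < α) (h : E d) (φ ψ : 𝓢(E d, ℝ)) :
    inner ℝ (potentialLp κ α (SchwartzMap.compSubConstCLM ℝ h φ))
        (potentialLp κ α (SchwartzMap.compSubConstCLM ℝ h ψ))
      = inner ℝ (potentialLp κ α φ) (potentialLp κ α ψ) := by
  simp_rw [inner_potentialLp, fracOp_neg_compSubConst hκ hα]
  exact integral_sub_right_eq_self (fun x ↦ fracOp κ (-α) φ x * fracOp κ (-α) ψ x) h

theorem memLp_integral_maternCov (hd : 0 < d) (hα : 0 < α) (hκ : 0 < κ)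
    (hη : η = (α - d) / 2) (ψ : 𝓢(E d, ℝ)) :
    MemLp (fun t ↦ ∫ s, maternCov η κ σ s t * ψ s) 2 (volume : Measure (E d)) := by
  simp_rw [integral_maternCov_mul_left hd hα hκ hη]
  exact ((fracOp κ (-α) ψ).memLp 2).const_mul _

theorem IsWhiteNoise.ae_wienerIntegral_maternCov (hW : IsWhiteNoise W P) (hd : 0 < d)
    (hα : 0 < α) (hκ : 0 < κ) (hσ : 0 < σ) (hη : η = (α - d) / 2) (ψ : 𝓢(E d, ℝ)) :
    ∀ᵐ ω ∂P, σ⁻¹ * wienerIntegral W (fun t ↦ ∫ s, maternCov η κ σ s t * ψ s) ω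
      = σ * W (potentialLp κ α ψ) ω := by
  have h : (memLp_integral_maternCov (σ := σ) hd hα hκ hη ψ).toLp
      = σ ^ 2 • potentialLp κ α ψ := by
    rw [potentialLp, SchwartzMap.toLp, ← MemLp.toLp_const_smul, MemLp.toLp_eq_toLp_iff]
    refine Filter.Eventually.of_forall fun t ↦ ?_
    simp only [integral_maternCov_mul_left hd hα hκ hη]
    rfl
  rw [wienerIntegral_of_memLp (memLp_integral_maternCov (σ := σ) hd hα hκ hη ψ), h]
  filter_upwards [hW.ae_map_smul (σ ^ 2) (potentialLp κ α ψ)] with ω hω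
  rw [hω]
  field_simp

/-- The stationary generalized solution is the isonormal process along the Bessel potential. -/
theorem IsWhiteNoise.generalized_iff (hW : IsWhiteNoise W P) (hα : 0 < α) (hκ : 0 < κ)
    (X : 𝓢(E d, ℝ) → Ω → ℝ) :
    (IsGeneralizedField X P ∧ IsStationaryGeneralized X P ∧ IsSolutionGeneralized W P α κ σ X) ↔
      ∀ ψ, ∀ᵐ ω ∂P, X ψ ω = σ * W (potentialLp κ α ψ) ω := by
  constructor
  · rintro ⟨-, -, hX⟩ ψ
    filter_upwards [hX (fracOp κ (-α) ψ)] with ω hω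
    rw [fracOp_fracOp_neg hκ, wienerIntegral_schwartz] at hω
    exact hω
  · intro hX
    have hmeas (ψ : 𝓢(E d, ℝ)) : AEMeasurable (X ψ) P :=
      ((hW.aemeasurable _).const_mul σ).congr ((hX ψ).mono fun _ h ↦ h.symm)
    refine ⟨⟨hmeas, fun a b φ ψ ↦ ?_, fun ψ ↦ ?_⟩, fun h I ↦ ?_, fun φ ↦ ?_⟩
    · filter_upwards [hX (a • φ + b • ψ), hX φ, hX ψ,
        hW.ae_map_add (a • potentialLp κ α φ) (b • potentialLp κ α ψ),
        hW.ae_map_smul a (potentialLp κ α φ), hW.ae_map_smul b (potentialLp κ α ψ)]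
        with ω h1 h2 h3 h4 h5 h6
      rw [h1, h2, h3, potentialLp_linear, h4, h5, h6]
      ring
    -- Convergence holds even in `L²(P)`, where the isometry reduces it to continuity of
    -- `potentialLp`.
    · refine tendstoInMeasure_of_tendsto_eLpNorm two_ne_zero
        (fun φ ↦ (hmeas φ).aestronglyMeasurable) (hmeas ψ).aestronglyMeasurable ?_
      have h1 (φ : 𝓢(E d, ℝ)) : eLpNorm (X φ - X ψ) 2 P
          = ‖σ‖ₑ * ENNReal.ofReal ‖potentialLp κ α φ - potentialLp κ α ψ‖ := by
        rw [← hW.eLpNorm_sub, ← eLpNorm_const_smul]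
        refine eLpNorm_congr_ae ?_
        filter_upwards [hX φ, hX ψ] with ω h2 h3
        simp only [Pi.sub_apply, Pi.smul_apply, h2, h3, smul_eq_mul]
        ring
      simp_rw [h1]
      have h2 : Filter.Tendsto (fun φ ↦ ‖potentialLp κ α φ - potentialLp κ α ψ‖) (𝓝 ψ) (𝓝 0) := by
        have := ((continuous_potentialLp (d := d) κ α).sub
          (continuous_const (y := potentialLp κ α ψ))).norm.tendsto ψ
        simpa using this
      have h3 := ENNReal.Tendsto.const_mul (a := ‖σ‖ₑ) (ENNReal.tendsto_ofReal h2)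
        (Or.inr (by finiteness))
      simpa using h3
    · exact hW.identDistrib_of_ae_eq (fun ψ : I ↦ hX _) (fun ψ : I ↦ hX ψ) fun φ ψ ↦
        inner_potentialLp_compSubConst hκ hα h φ ψ
    · filter_upwards [hX (fracOp κ α φ)] with ω hω
      rw [hω, potentialLp_fracOp hκ, wienerIntegral_schwartz]

end Generalized

/-! ### Separating test functions, translations in `L²`, joint measurability. -/

/-- Countably many test functions separate, up to null sets, the functions whose products with them
are integrable. -/
theorem exists_countable_separating (d : ℕ) : ∃ ψ : ℕ → 𝓢(E d, ℝ), ∀ u v : E d → ℝ,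
    (∀ n, Integrable (fun s ↦ ψ n s * u s)) → (∀ n, Integrable (fun s ↦ ψ n s * v s)) →
    (∀ n, ∫ s, ψ n s * u s = ∫ s, ψ n s * v s) → u =ᵐ[volume] v := by
  -- Two families: the wide bumps `b` force local integrability; the translates of the shrinking
  -- bumps `ρ` to dense centres record mollifications.
  let b (n : ℕ) : ContDiffBump (0 : E d) := ⟨n + 1, n + 2, by positivity, by linarith⟩
  let ρ (n : ℕ) : ContDiffBump (0 : E d) :=
    ⟨1 / (n + 1), 2 * (1 / (n + 1)), by positivity, lt_two_mul_self (by positivity)⟩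
  let q : ℕ → E d := TopologicalSpace.denseSeq (E d)
  let B (n : ℕ) : 𝓢(E d, ℝ) := (b n).hasCompactSupport.toSchwartzMap (b n).contDiff
  let R (n : ℕ) : 𝓢(E d, ℝ) :=
    ((ρ n).hasCompactSupport_normed (μ := volume)).toSchwartzMap (ρ n).contDiff_normed
  let f : ℕ ⊕ ℕ × ℕ → 𝓢(E d, ℝ) :=
    Sum.elim B fun p ↦ SchwartzMap.compSubConstCLM ℝ (q p.2) (R p.1)
  obtain ⟨e⟩ : Nonempty (ℕ ≃ ℕ ⊕ ℕ × ℕ) := ⟨(Denumerable.eqv _).symm⟩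
  refine ⟨f ∘ e, fun u v hu hv huv ↦ ?_⟩
  have hloc (u : E d → ℝ) (hu : ∀ n, Integrable (fun s ↦ (f ∘ e) n s * u s)) :
      LocallyIntegrable u := by
    intro x
    obtain ⟨n, hn⟩ := exists_nat_gt ‖x‖
    refine ⟨Metric.ball 0 n, Metric.isOpen_ball.mem_nhds (by simpa using hn), ?_⟩
    have h1 := (hu (e.symm (Sum.inl n))).integrableOn (s := Metric.ball 0 (n : ℝ))
    refine h1.congr_fun (fun s hs ↦ ?_) measurableSet_ball
    have h2 : b n s = 1 := by
      refine (b n).one_of_mem_closedBall ?_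
      have : dist s 0 < n := hs
      simp only [Metric.mem_closedBall, b]
      linarith
    simp only [Function.comp_apply, Equiv.apply_symm_apply, f, Sum.elim_inl, B,
      HasCompactSupport.toSchwartzMap_toFun, h2, one_mul]
  have hconv (u : E d → ℝ) (n : ℕ) (x : E d) :
      (MeasureTheory.convolution ((ρ n).normed volume) u (ContinuousLinearMap.lsmul ℝ ℝ) volume) x
        = ∫ s, (ρ n).normed volume (s - x) * u s := by
    rw [convolution_eq_swap]
    congr 1
    funext s
    rw [ContinuousLinearMap.lsmul_apply, smul_eq_mul, ← (ρ n).normed_neg, neg_sub]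
  have hcont (u : E d → ℝ) (hu : LocallyIntegrable u) (n : ℕ) :
      Continuous (MeasureTheory.convolution ((ρ n).normed volume) u
        (ContinuousLinearMap.lsmul ℝ ℝ) volume) :=
    (ρ n).hasCompactSupport_normed.continuous_convolution_left _ (ρ n).continuous_normed hu
  -- Mollifications are continuous, so agreement at the dense centres is agreement everywhere.
  have heq (n : ℕ) : MeasureTheory.convolution ((ρ n).normed volume) u
        (ContinuousLinearMap.lsmul ℝ ℝ) volume =
      MeasureTheory.convolution ((ρ n).normed volume) v (ContinuousLinearMap.lsmul ℝ ℝ) volume := by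
    refine (TopologicalSpace.denseRange_denseSeq (E d)).equalizer (hcont u (hloc u hu) n)
      (hcont v (hloc v hv) n) ?_
    funext k
    have h := huv (e.symm (Sum.inr (n, k)))
    simp only [Function.comp_apply, Equiv.apply_symm_apply, f, Sum.elim_inr] at h
    rw [Function.comp_apply, Function.comp_apply, hconv, hconv]
    exact h
  have hrad : Filter.Tendsto (fun n ↦ (ρ n).rOut) Filter.atTop (𝓝 0) := by
    have := (tendsto_one_div_add_atTop_nhds_zero_nat (𝕜 := ℝ)).const_mul 2
    simpa [ρ] using this
  -- Mollifications converge almost everywhere; `K = 2` is the ratio of outer to inner radius of `ρ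
  -- n`.
  have hlim (u : E d → ℝ) (hu : LocallyIntegrable u) :=
    ContDiffBump.ae_convolution_tendsto_right_of_locallyIntegrable (φ := ρ) (K := 2) hrad
      (Filter.Eventually.of_forall fun n ↦ le_rfl) hu
  filter_upwards [hlim u (hloc u hu), hlim v (hloc v hv)] with x h1 h2
  simp_rw [heq] at h1
  exact tendsto_nhds_unique h1 h2

/-- Translation is continuous in `L²`. -/
theorem continuous_toLp_comp_sub {d : ℕ} {k : E d → ℝ} (hk : MemLp k 2 volume)
    (h : ∀ s, MemLp (fun t ↦ k (t - s)) 2 volume) : Continuous fun s ↦ (h s).toLp := by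
  let g : E d → C(E d, E d) := fun s ↦ ⟨fun t ↦ t - s, by fun_prop⟩
  have hg : Continuous g := ContinuousMap.continuous_of_continuous_uncurry _ (by
    simp only [g, ContinuousMap.coe_mk]
    fun_prop)
  have hgm (s : E d) : MeasurePreserving (g s) volume volume := measurePreserving_sub_right volume s
  refine (Continuous.compMeasurePreservingLp (continuous_const (y := hk.toLp)) hg hgm
    ENNReal.ofNat_ne_top).congr fun s ↦ ?_
  exact Lp.toLp_compMeasurePreserving hk (hgm s)

theorem measurable_macdonaldK (ν : ℝ) : Measurable (macdonaldK ν) := by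
  have h : Measurable (Function.uncurry fun (x u : ℝ) ↦
      u ^ (ν - 1) * exp (-(x / 2) * (u + 1 / u))) := by
    unfold Function.uncurry
    fun_prop
  exact (h.stronglyMeasurable.integral_prod_right
    (ν := volume.restrict (Ioi 0))).measurable.const_mul
    (1 / 2)

theorem measurable_powMacdonald (η : ℝ) : Measurable (powMacdonald η) := by
  unfold powMacdonald
  refine Measurable.ite (measurableSet_singleton 0) measurable_const ?_
  exact (by fun_prop : Measurable fun r : ℝ ↦ r ^ η).mul (measurable_macdonaldK η)

theorem measurable_uncurry_maternCov {d : ℕ} (η κ σ : ℝ) :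
    Measurable (Function.uncurry (maternCov (d := d) η κ σ)) :=
  ((measurable_powMacdonald η).comp (f := fun p : E d × E d ↦ κ * ‖p.1 - p.2‖)
    (by fun_prop)).const_mul _

/-! ### Random fields with values at points. -/

section Field

variable {Ω : Type*} [MeasurableSpace Ω] {P : Measure Ω} {d : ℕ}
  {W : Lp ℝ 2 (volume : Measure (E d)) → Ω → ℝ} {α κ σ η : ℝ}

/-- The class in `L²` of `c_η(s, ·)`. -/
noncomputable def maternLp (η κ σ : ℝ)
    (hm : ∀ s : E d, MemLp (fun t ↦ maternCov η κ σ s t) 2 (volume : Measure (E d))) (s : E d) :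
    Lp ℝ 2 (volume : Measure (E d)) :=
  (hm s).toLp

variable (hm : ∀ s : E d, MemLp (fun t ↦ maternCov η κ σ s t) 2 (volume : Measure (E d)))

theorem continuous_maternLp : Continuous (maternLp η κ σ hm) := by
  have h (s t : E d) : maternCov η κ σ 0 (t - s) = maternCov η κ σ s t := by
    rw [← maternCov_add_right, zero_add]
  have hm' (s : E d) : MemLp (fun t ↦ maternCov η κ σ 0 (t - s)) 2 volume := by
    simp_rw [h]
    exact hm s
  refine (continuous_toLp_comp_sub (hm 0) hm').congr fun s ↦ ?_
  simp_rw [h]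
  rfl

theorem inner_maternLp (s t : E d) : inner ℝ (maternLp η κ σ hm s) (maternLp η κ σ hm t)
    = ∫ x, maternCov η κ σ s x * maternCov η κ σ t x := by
  rw [L2.inner_def]
  refine integral_congr_ae ?_
  filter_upwards [(hm s).coeFn_toLp, (hm t).coeFn_toLp] with x h1 h2
  rw [maternLp, maternLp, h1, h2]
  simp [mul_comm]

theorem inner_maternLp_add (s t h : E d) :
    inner ℝ (maternLp η κ σ hm (s + h)) (maternLp η κ σ hm (t + h))
      = inner ℝ (maternLp η κ σ hm s) (maternLp η κ σ hm t) := by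
  simp_rw [inner_maternLp, maternCov_add_right]
  exact integral_sub_right_eq_self (fun x ↦ maternCov η κ σ s x * maternCov η κ σ t x) h

/-- Constancy of the norm makes `ψ s • maternLp η κ σ hm s` Bochner integrable, with bound a
multiple of `|ψ|`. -/
theorem norm_maternLp (s : E d) : ‖maternLp η κ σ hm s‖ = ‖maternLp η κ σ hm 0‖ := by
  rw [← sq_eq_sq₀ (norm_nonneg _) (norm_nonneg _), ← real_inner_self_eq_norm_sq,
    ← real_inner_self_eq_norm_sq, ← inner_maternLp_add hm 0 0 s, zero_add]

theorem isConvolutionField_iff {X : E d → Ω → ℝ} : IsConvolutionField W P η κ σ X ↔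
    ∀ s, ∀ᵐ ω ∂P, X s ω = σ⁻¹ * W (maternLp η κ σ hm s) ω := by
  simp_rw [IsConvolutionField, wienerIntegral_of_memLp (hm _)]
  rfl

theorem IsWhiteNoise.exists_isConvolutionField
    (hm : ∀ s : E d, MemLp (fun t ↦ maternCov η κ σ s t) 2 (volume : Measure (E d)))
    (hW : IsWhiteNoise W P) :
    ∃ Z : E d → Ω → ℝ, Measurable (Function.uncurry Z) ∧ IsConvolutionField W P η κ σ Z := by
  obtain ⟨Z, hZ, h⟩ := exists_measurable_uncurry_of_continuous
    ((hW.isometry.continuous.comp (continuous_maternLp hm)).const_smul σ⁻¹)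
  refine ⟨Z, hZ, (isConvolutionField_iff hm).2 fun s ↦ ?_⟩
  filter_upwards [h s, Lp.coeFn_smul σ⁻¹ (hW.isometry (maternLp η κ σ hm s)),
    hW.coeFn_isometry (maternLp η κ σ hm s)] with ω h1 h2 h3
  rw [h1]
  refine h2.trans ?_
  rw [Pi.smul_apply, h3, smul_eq_mul]

theorem IsConvolutionField.isStationaryField
    (hm : ∀ s : E d, MemLp (fun t ↦ maternCov η κ σ s t) 2 (volume : Measure (E d)))
    (hW : IsWhiteNoise W P) {X : E d → Ω → ℝ}
    (hX : IsConvolutionField W P η κ σ X) : IsStationaryField X P := by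
  rw [isConvolutionField_iff hm] at hX
  exact fun h I ↦ hW.identDistrib_of_ae_eq (fun s : I ↦ hX (s + h)) (fun s : I ↦ hX s)
    fun s t ↦ inner_maternLp_add hm s t h

theorem integrable_smul_maternLp (ψ : 𝓢(E d, ℝ)) :
    Integrable fun s ↦ ψ s • maternLp η κ σ hm s := by
  refine (ψ.integrable.norm.mul_const ‖maternLp η κ σ hm 0‖).mono'
    (ψ.continuous.smul (continuous_maternLp hm)).aestronglyMeasurable
    (Filter.Eventually.of_forall fun s ↦ ?_)
  rw [norm_smul, norm_maternLp]

/-- Read pointwise by `coeFn_integral_Lp`, the Bochner integral is the kernel integral representing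
the Bessel potential. -/
theorem integral_smul_maternLp (hd : 0 < d) (hα : 0 < α) (hκ : 0 < κ) (hη : η = (α - d) / 2)
    (ψ : 𝓢(E d, ℝ)) : ∫ s, ψ s • maternLp η κ σ hm s = σ ^ 2 • potentialLp κ α ψ := by
  have hK : Measurable (Function.uncurry fun s t : E d ↦ ψ s * maternCov η κ σ s t) :=
    (ψ.continuous.measurable.comp measurable_fst).mul (measurable_uncurry_maternCov η κ σ)
  ext1
  refine (coeFn_integral_Lp hK.aestronglyMeasurable (integrable_smul_maternLp hm ψ)
    fun s ↦ ?_).trans ?_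
  · filter_upwards [Lp.coeFn_smul (ψ s) (maternLp η κ σ hm s), (hm s).coeFn_toLp] with t h1 h2
    rw [h1, Pi.smul_apply, maternLp, h2, smul_eq_mul]
  · filter_upwards [Lp.coeFn_smul (σ ^ 2) (potentialLp κ α ψ),
      (fracOp κ (-α) ψ).coeFn_toLp 2] with t h1 h2
    rw [h1, Pi.smul_apply, potentialLp, h2, smul_eq_mul,
      ← integral_maternCov_mul_left hd hα hκ hη]
    simp_rw [mul_comm]

/-- Stochastic Fubini theorem for the convolution of white noise with the Matérn kernel. -/
theorem IsConvolutionField.ae_integral [SFinite P]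
    (hm : ∀ s : E d, MemLp (fun t ↦ maternCov η κ σ s t) 2 (volume : Measure (E d)))
    (hW : IsWhiteNoise W P) (hd : 0 < d)
    (hα : 0 < α) (hκ : 0 < κ) (hσ : 0 < σ) (hη : η = (α - d) / 2) {Z : E d → Ω → ℝ}
    (hZm : Measurable (Function.uncurry Z)) (hZ : IsConvolutionField W P η κ σ Z)
    (ψ : 𝓢(E d, ℝ)) :
    ∀ᵐ ω ∂P, Integrable (fun s ↦ ψ s * Z s ω) ∧
      ∫ s, ψ s * Z s ω = σ * W (potentialLp κ α ψ) ω := by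
  have := hW.gaussian.isProbabilityMeasure
  rw [isConvolutionField_iff hm] at hZ
  -- `L` sends `c_η(s, ·)` to the class of `Z s`. Being bounded it commutes with the Bochner
  -- integral over `s`, and pointwise reading in `ω` turns this into Fubini.
  let L : Lp ℝ 2 (volume : Measure (E d)) →L[ℝ] Lp ℝ 2 P :=
    σ⁻¹ • hW.isometry.toContinuousLinearMap
  have hK : Measurable (Function.uncurry fun s ω ↦ ψ s * Z s ω) :=
    (ψ.continuous.measurable.comp measurable_fst).mul hZm
  have hΦ : Integrable fun s ↦ L (ψ s • maternLp η κ σ hm s) :=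
    L.integrable_comp (integrable_smul_maternLp hm ψ)
  have h (s : E d) : L (ψ s • maternLp η κ σ hm s) =ᵐ[P] fun ω ↦ ψ s * Z s ω := by
    rw [map_smul]
    filter_upwards [Lp.coeFn_smul (ψ s) (L (maternLp η κ σ hm s)),
      Lp.coeFn_smul σ⁻¹ (hW.isometry (maternLp η κ σ hm s)),
      hW.coeFn_isometry (maternLp η κ σ hm s), hZ s] with ω h1 h2 h3 h4
    rw [h1, Pi.smul_apply, smul_eq_mul, h4]
    congr 1
    refine h2.trans ?_
    rw [Pi.smul_apply, h3, smul_eq_mul]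
  have hint := coeFn_integral_Lp hK.aestronglyMeasurable hΦ h
  rw [L.integral_comp_comm (integrable_smul_maternLp hm ψ),
    integral_smul_maternLp hm hd hα hκ hη] at hint
  have hL : L (σ ^ 2 • potentialLp κ α ψ) = σ • hW.isometry (potentialLp κ α ψ) := by
    rw [map_smul]
    change σ ^ 2 • σ⁻¹ • hW.isometry _ = _
    rw [smul_smul]
    congr 1
    field_simp
  rw [hL] at hint
  filter_upwards [ae_integrable_of_integrable_Lp hK.aestronglyMeasurable hΦ h, hint,
    Lp.coeFn_smul σ (hW.isometry (potentialLp κ α ψ)),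
    hW.coeFn_isometry (potentialLp κ α ψ)] with ω h1 h2 h3 h4
  refine ⟨h1, ?_⟩
  rw [← h2, h3, Pi.smul_apply, h4, smul_eq_mul]

/-- A change of test function `ψ = (κ² - Δ)^{α/2} φ`, which is a bijection. -/
theorem isSolutionField_iff (hκ : 0 < κ) {X : E d → Ω → ℝ} :
    IsSolutionField W P α κ σ X ↔ ∀ ψ : 𝓢(E d, ℝ), ∀ᵐ ω ∂P,
      Integrable (fun s ↦ ψ s * X s ω) ∧ ∫ s, ψ s * X s ω = σ * W (potentialLp κ α ψ) ω := by
  simp_rw [IsSolutionField, wienerIntegral_schwartz, mul_comm (X _ _)]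
  constructor
  · intro h ψ
    have := h (fracOp κ (-α) ψ)
    rwa [fracOp_fracOp_neg hκ] at this
  · intro h φ
    have := h (fracOp κ α φ)
    rwa [potentialLp_fracOp hκ] at this

/-- Two fields with the same integrals against test functions agree at almost every point. -/
theorem ae_eq_of_integral_eq [SFinite P] {X Z : E d → Ω → ℝ}
    (hX : Measurable (Function.uncurry X)) (hZ : Measurable (Function.uncurry Z))
    (h : ∀ ψ : 𝓢(E d, ℝ), ∀ᵐ ω ∂P, Integrable (fun s ↦ ψ s * X s ω) ∧
      Integrable (fun s ↦ ψ s * Z s ω) ∧ ∫ s, ψ s * X s ω = ∫ s, ψ s * Z s ω) :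
    ∀ᵐ s, ∀ᵐ ω ∂P, X s ω = Z s ω := by
  obtain ⟨ψ, hψ⟩ := exists_countable_separating d
  -- Countability leaves a single null set of `ω`; joint measurability then allows the two
  -- quantifiers to be exchanged.
  have h1 : ∀ᵐ ω ∂P, ∀ᵐ s, X s ω = Z s ω := by
    filter_upwards [ae_all_iff.2 fun n ↦ h (ψ n)] with ω hω
    exact hψ _ _ (fun n ↦ (hω n).1) (fun n ↦ (hω n).2.1) fun n ↦ (hω n).2.2
  refine (Measure.ae_ae_comm (p := fun s ω ↦ X s ω = Z s ω) ?_).2 h1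
  exact measurableSet_eq_fun hX hZ

/-- The norm depends only on the joint law of two values. No second moments are assumed, so both
sides may be infinite. -/
theorem IsStationaryField.eLpNorm_sub_add {X : E d → Ω → ℝ} (hX : IsStationaryField X P)
    (a b h : E d) :
    eLpNorm (fun ω ↦ X (a + h) ω - X (b + h) ω) 2 P = eLpNorm (fun ω ↦ X a ω - X b ω) 2 P := by
  classical
  have h1 := (hX h {a, b}).comp
    (u := fun v : ({a, b} : Finset (E d)) → ℝ ↦ v ⟨a, by simp⟩ - v ⟨b, by simp⟩) (by fun_prop)
  exact h1.eLpNorm_eq 2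

/-- A stationary field that agrees with an `L²`-continuous field at almost every point agrees with
it everywhere. -/
theorem IsStationaryField.ae_eq_of_ae_ae_eq {X : E d → Ω → ℝ} (hX : IsStationaryField X P)
    (hXm : ∀ s, AEMeasurable (X s) P) {Φ : E d → Lp ℝ 2 P} (hΦ : Continuous Φ)
    (h : ∀ᵐ s, X s =ᵐ[P] Φ s) (s : E d) : X s =ᵐ[P] Φ s := by
  have hdist := hX.eLpNorm_sub_add
  have hΦdist (a b : E d) :
      eLpNorm (fun ω ↦ Φ a ω - Φ b ω) 2 P = ENNReal.ofReal ‖Φ a - Φ b‖ := by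
    rw [Lp.norm_def, ENNReal.ofReal_toReal (Lp.eLpNorm_ne_top _)]
    exact eLpNorm_congr_ae (Lp.coeFn_sub _ _).symm
  have hdense : Dense {s | X s =ᵐ[P] Φ s} := Measure.dense_of_ae h
  obtain ⟨x, hxA, hx⟩ := mem_closure_iff_seq_limit.1 (hdense s)
  have hshift (y : E d) : ∀ᵐ t, X (y + t) =ᵐ[P] Φ (y + t) :=
    (measurePreserving_add_left volume y).quasiMeasurePreserving.ae h
  -- One shift `t` moves `s` and all the `x n` into the good set. Stationarity then equates the
  -- increment of `X` from `x n` to `s` with an increment of `Φ`, which tends to zero.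
  obtain ⟨t, ht0, ht⟩ := ((hshift s).and (ae_all_iff.2 fun n ↦ hshift (x n))).exists
  have hbound (n : ℕ) : eLpNorm (fun ω ↦ X s ω - Φ s ω) 2 P
      ≤ ENNReal.ofReal ‖Φ (s + t) - Φ (x n + t)‖ + ENNReal.ofReal ‖Φ (x n) - Φ s‖ := by
    have h1 : eLpNorm (fun ω ↦ X s ω - X (x n) ω) 2 P
        = ENNReal.ofReal ‖Φ (s + t) - Φ (x n + t)‖ := by
      rw [← hdist s (x n) t, ← hΦdist]
      refine eLpNorm_congr_ae ?_
      filter_upwards [ht0, ht n] with ω h2 h3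
      rw [h2, h3]
    have h2 : eLpNorm (fun ω ↦ X (x n) ω - Φ s ω) 2 P = ENNReal.ofReal ‖Φ (x n) - Φ s‖ := by
      rw [← hΦdist]
      refine eLpNorm_congr_ae ?_
      filter_upwards [hxA n] with ω h3
      rw [h3]
    rw [← h1, ← h2]
    refine le_trans (le_of_eq ?_) (eLpNorm_add_le
      ((hXm s).sub (hXm (x n))).aestronglyMeasurable
      ((hXm (x n)).sub (Lp.aestronglyMeasurable (Φ s)).aemeasurable).aestronglyMeasurable
      one_le_two)
    congr 1
    funext ω
    simp
  have hlim : Filter.Tendsto (fun n ↦ ENNReal.ofReal ‖Φ (s + t) - Φ (x n + t)‖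
      + ENNReal.ofReal ‖Φ (x n) - Φ s‖) Filter.atTop (𝓝 0) := by
    have h1 : Filter.Tendsto (fun n ↦ ‖Φ (s + t) - Φ (x n + t)‖) Filter.atTop (𝓝 0) := by
      have := (Continuous.tendsto (f := fun y ↦ ‖Φ (s + t) - Φ (y + t)‖) (by fun_prop) s).comp hx
      simpa [Function.comp_def] using this
    have h2 : Filter.Tendsto (fun n ↦ ‖Φ (x n) - Φ s‖) Filter.atTop (𝓝 0) := by
      have := (Continuous.tendsto (f := fun y ↦ ‖Φ y - Φ s‖) (by fun_prop) s).comp hx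
      simpa [Function.comp_def] using this
    simpa using (ENNReal.tendsto_ofReal h1).add (ENNReal.tendsto_ofReal h2)
  have hzero : eLpNorm (X s - (Φ s : Ω → ℝ)) 2 P = 0 :=
    le_antisymm (ge_of_tendsto' hlim hbound) bot_le
  rw [eLpNorm_eq_zero_iff ((hXm s).sub
    (Lp.aestronglyMeasurable (Φ s)).aemeasurable).aestronglyMeasurable two_ne_zero] at hzero
  filter_upwards [hzero] with ω hω
  exact sub_eq_zero.1 hω

end Field

end Whittle

/-! ### Whittle's theorem. -/

theorem theoremW {Ω : Type*} [MeasurableSpace Ω] (P : Measure Ω) [IsProbabilityMeasure P]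
    (d : ℕ) (hd : 0 < d) (α κ σ η : ℝ) (hα : 0 < α) (hκ : 0 < κ) (hσ : 0 < σ)
    (hη : η = (α - d) / 2)
    (W : Lp ℝ 2 (volume : Measure (Whittle.E d)) → Ω → ℝ) (hW : Whittle.IsWhiteNoise W P) :
    -- the Matérn function `σ⁻² c_η` is the kernel of the Bessel potential
    (∀ s : Whittle.E d, Integrable (fun t ↦ Whittle.maternCov η κ σ s t)) ∧
    (∀ ξ : Whittle.E d,
      𝓕 (fun x : Whittle.E d ↦ (((σ ^ 2)⁻¹ * Whittle.maternCov η κ σ x 0 : ℝ) : ℂ)) ξ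
        = (((κ ^ 2 + 4 * π ^ 2 * ‖ξ‖ ^ 2) ^ (-α / 2) : ℝ) : ℂ)) ∧
    (∀ (ψ : 𝓢(Whittle.E d, ℝ)) (s : Whittle.E d),
      Integrable (fun t ↦ Whittle.maternCov η κ σ s t * ψ t) ∧
      Whittle.fracOp κ (-α) ψ s = (σ ^ 2)⁻¹ * ∫ t, Whittle.maternCov η κ σ s t * ψ t) ∧
    -- generalized random fields, all `α > 0`
    (∀ ψ : 𝓢(Whittle.E d, ℝ),
      MemLp (fun t ↦ ∫ s, Whittle.maternCov η κ σ s t * ψ s) 2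
        (volume : Measure (Whittle.E d))) ∧
    (∀ X : 𝓢(Whittle.E d, ℝ) → Ω → ℝ,
      (Whittle.IsGeneralizedField X P ∧ Whittle.IsStationaryGeneralized X P ∧
          Whittle.IsSolutionGeneralized W P α κ σ X) ↔
        ∀ ψ : 𝓢(Whittle.E d, ℝ), ∀ᵐ ω ∂P,
          X ψ ω = σ⁻¹ *
            Whittle.wienerIntegral W (fun t ↦ ∫ s, Whittle.maternCov η κ σ s t * ψ s) ω) ∧
    -- random fields with values at points, `α > d/2`
    ((d : ℝ) / 2 < α →
      (∀ s : Whittle.E d,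
        MemLp (fun t ↦ Whittle.maternCov η κ σ s t) 2 (volume : Measure (Whittle.E d))) ∧
      (∃ Z : Whittle.E d → Ω → ℝ, Measurable (Function.uncurry Z) ∧
        Whittle.IsConvolutionField W P η κ σ Z) ∧
      (∀ X : Whittle.E d → Ω → ℝ, Measurable (Function.uncurry X) →
        ((Whittle.IsStationaryField X P ∧ Whittle.IsSolutionField W P α κ σ X) ↔
          Whittle.IsConvolutionField W P η κ σ X)) ∧
      (∀ Z : Whittle.E d → Ω → ℝ, Measurable (Function.uncurry Z) →
        Whittle.IsConvolutionField W P η κ σ Z →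
        ∀ X : Whittle.E d → Ω → ℝ, Measurable (Function.uncurry X) →
          (Whittle.IsSolutionField W P α κ σ X ↔
            ∀ ψ : 𝓢(Whittle.E d, ℝ), ∀ᵐ ω ∂P,
              Integrable (fun s ↦ ψ s * X s ω) ∧ Integrable (fun s ↦ ψ s * Z s ω) ∧
                ∫ s, ψ s * X s ω = ∫ s, ψ s * Z s ω))) := by
  refine ⟨Whittle.integrable_maternCov hd hα hκ hη, Whittle.fourier_maternCov hd hα hκ hσ hη,
    fun ψ s ↦ ⟨Whittle.integrable_maternCov_mul hd hα hκ hη ψ s, ?_⟩,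
    Whittle.memLp_integral_maternCov hd hα hκ hη, fun X ↦ ?_, fun hα2 ↦ ?_⟩
  · rw [Whittle.integral_maternCov_mul hd hα hκ hη, inv_mul_cancel_left₀ (by positivity)]
  · rw [hW.generalized_iff hα hκ]
    refine forall_congr' fun ψ ↦ Filter.eventually_congr ?_
    filter_upwards [hW.ae_wienerIntegral_maternCov hd hα hκ hσ hη ψ] with ω hω
    rw [hω]
  have hm := Whittle.memLp_two_maternCov (σ := σ) hd hα2 hκ hη
  have hconv {Z : Whittle.E d → Ω → ℝ} (hZm : Measurable (Function.uncurry Z))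
      (hZ : Whittle.IsConvolutionField W P η κ σ Z) :=
    hZ.ae_integral hm hW hd hα hκ hσ hη hZm
  obtain ⟨Z₀, hZ₀m, hZ₀⟩ := hW.exists_isConvolutionField hm
  refine ⟨hm, ⟨Z₀, hZ₀m, hZ₀⟩, fun X hX ↦ ⟨?_, fun h ↦ ⟨h.isStationaryField hm hW,
    (Whittle.isSolutionField_iff hκ).2 (hconv hX h)⟩⟩, fun Z hZm hZ X hX ↦ ?_⟩
  · rintro ⟨hstat, hsol⟩
    rw [Whittle.isSolutionField_iff hκ] at hsol
    have hΦ (s : Whittle.E d) :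
        ((σ⁻¹ • hW.isometry (Whittle.maternLp η κ σ hm s) : Lp ℝ 2 P) : Ω → ℝ) =ᵐ[P]
          fun ω ↦ σ⁻¹ * W (Whittle.maternLp η κ σ hm s) ω := by
      filter_upwards [Lp.coeFn_smul σ⁻¹ (hW.isometry (Whittle.maternLp η κ σ hm s)),
        hW.coeFn_isometry (Whittle.maternLp η κ σ hm s)] with ω h1 h2
      rw [h1, Pi.smul_apply, h2, smul_eq_mul]
    have hae : ∀ᵐ s, ∀ᵐ ω ∂P, X s ω = Z₀ s ω := by
      refine Whittle.ae_eq_of_integral_eq hX hZ₀m fun ψ ↦ ?_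
      filter_upwards [hsol ψ, hconv hZ₀m hZ₀ ψ] with ω h1 h2
      exact ⟨h1.1, h2.1, h1.2.trans h2.2.symm⟩
    rw [Whittle.isConvolutionField_iff hm] at hZ₀ ⊢
    intro s
    -- The comparison field is `s ↦ σ⁻¹ W(c_η(s, ·))` as a continuous map into `L²(P)`; it removes
    -- the exceptional null set of points `s`.
    refine (hstat.ae_eq_of_ae_ae_eq (fun s ↦ (hX.comp measurable_prodMk_left).aemeasurable)
      ((hW.isometry.continuous.comp (Whittle.continuous_maternLp hm)).const_smul σ⁻¹) ?_ s).trans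
      (hΦ s)
    filter_upwards [hae] with s hs
    filter_upwards [hs, hZ₀ s, hΦ s] with ω h1 h2 h3
    rw [h1, h2]
    exact h3.symm
  · rw [Whittle.isSolutionField_iff hκ]
    refine forall_congr' fun ψ ↦ Filter.eventually_congr ?_
    filter_upwards [hconv hZm hZ ψ] with ω hω
    rw [hω.2]
    simp only [hω.1, true_and]
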